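/- **Theories.** $QT^+$ is the first-order theory with identity in the language $\{a,b,S,*\}$ ($a,b$ constants, $S$ unary, $*$ binary) whose axioms are the universal closures of - (QT1) $(x*y)*z=x*(y*z)$; - (QT2) $\neg(x*y=a)\wedge\neg(x*y=b)$; - (QT3) $(x*a=y*a\to x=y)\wedge(x*b=y*b\to x=y)\wedge(a*x=a*y\to x=y)\wedge(b*x=b*y\to x=y)$; - (QT4) $\neg(a*x=b*y)\wedge\neg(x*a=y*b)$; - (QT5) $x=a\vee x=b\vee(\exists y(a*y=x\vee b*y=x)\wedge\exists z(z*a=x\vee z*b=x))$; - (QT6) $Sx=y\leftrightarrow((x=a\wedge y=b)\vee(\neg x=a\wedge x*b=y))$. $I\Sigma_0$ is the theory in the language $\{0,{}',+,\cdot\}$ that consists of Robinson arithmetic ($\neg x'=0$; $x'=y'\to x=y$; $x=0\vee\exists y\,y'=x$; $x+0=x$; $x+y'=(x+y)'$; $x\cdot0=0$; $x\cdot y'=x\cdot y+x$) and of the induction axioms $\varphi(0)\wedge\forall x(\varphi(x)\to\varphi(x'))\to\forall x\,\varphi(x)$ for all bounded formulas $\varphi$, possibly with parameters; a formula is bounded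 if all its quantifiers are of the form $\forall x\le t$ or $\exists x\le t$ ($t$ a term without $x$), where $x\le y$ abbreviates $\exists z\,(z+x=y)$. $T\vdash\varphi$ means that $\varphi$ is a consequence of $T$, i.e. it is satisfied in every model of $T$ under every assignment (equivalently, by Gödel's completeness theorem, $\varphi$ is derivable from $T$). A theory $T$ is *interpretable* in $T'$ if there is a translation (a formula $\delta(x)$ for the domain, and for each function or relation symbol of $T$ a formula of the language of $T'$; equality is kept, quantifiers are relativized to $\delta$, nested terms are unnested) such that $T'$ proves that $\delta$ is nonempty, that the formulas for the function symbols define functions on $\delta$, and the translation of each axiom of $T$. **Theorem.** $QT^+$ is interpretable in $I\Sigma_0$. More precisely, there are bounded formulas $Seq(x)$, $x\in y$ and $x\,\hat{\ }\,y=z$ in the language of arithmetic, a term $p(x,y)$, and variable-free terms $\underline c_1,\underline c_2$ with the following properties. 1. In the standard model, for some injective function from finite sequences of natural numbers (including the empty one) to natural numbers, called their codes, $Seq$ defines the set of codes, $x\in y$ holds for a code $y$ iff $x$ is a term of the sequence coded by $y$, $x\,\hat{\ }\,y=z$ holds for codes $x,y$ iff $z$ is the code of the concatenation of the two sequences, and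 $\underline c_1,\underline c_2$ denote the codes of the one-term sequences $\langle1\rangle$, $\langle2\rangle$. 2. $I\Sigma_0$ proves that $\hat{\ }$ is a total function, that $x\,\hat{\ }\,y\le p(x,y)$, and that $x\,\hat{\ }\,y=0$ unless $Seq(x)\wedge Seq(y)$. 3. Let $Seq^*(x)$ be $Seq(x)\wedge\exists y\,(y\in x)\wedge\forall y\,(y\in x\to y=0'\vee y=0'')$. Let $Single_i(s)$ be $Seq^*(s)\wedge\forall x(x\in s\leftrightarrow x=\underline i)\wedge\neg\exists u\exists v(Seq^*(u)\wedge Seq^*(v)\wedge u\,\hat{\ }\,v=s)$ for $i=1,2$, where $\underline 1=0'$, $\underline 2=0''$. Then $I\Sigma_0$ proves - (t0) $\exists s\,Seq^*(s)$; - (t1) $\exists!s\,Single_1(s)$, and $Single_1(\underline c_1)$; - (t2) $\exists!s\,Single_2(s)$, and $Single_2(\underline c_2)$; - (t3) $Seq^*(s)\wedge Seq^*(t)\to\exists!u(Seq^*(u)\wedge s\,\hat{\ }\,t=u)$; - (t4) $Seq^*(s)\wedge Seq^*(t)\wedge Seq^*(u)\to(s\,\hat{\ }\,t)\,\hat{\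 }\,u=s\,\hat{\ }\,(t\,\hat{\ }\,u)$; - (t5) $Seq^*(s)\wedge Seq^*(t)\to\neg(s\,\hat{\ }\,t=\underline c_1)\wedge\neg(s\,\hat{\ }\,t=\underline c_2)$; - (t6) $Seq^*(s)\wedge Seq^*(t)\to(\underline c_1\hat{\ }s=\underline c_1\hat{\ }t\to s=t)\wedge(\underline c_2\hat{\ }s=\underline c_2\hat{\ }t\to s=t)$; - (t7) $Seq^*(s)\wedge Seq^*(t)\to(s\,\hat{\ }\,\underline c_1=t\,\hat{\ }\,\underline c_1\to s=t)\wedge(s\,\hat{\ }\,\underline c_2=t\,\hat{\ }\,\underline c_2\to s=t)$; - (t8) $Seq^*(s)\wedge Seq^*(t)\to\neg(\underline c_1\hat{\ }s=\underline c_2\hat{\ }t)\wedge\neg(s\,\hat{\ }\,\underline c_1=t\,\hat{\ }\,\underline c_2)$; - (t9) $Seq^*(s)\to s=\underline c_1\vee s=\underline c_2\vee\bigl(\exists t(Seq^*(t)\wedge(\underline c_1\hat{\ }t=s\vee\underline c_2\hat{\ }t=s))\wedge\exists t(Seq^*(t)\wedge(t\,\hat{\ }\,\underline c_1=s\vee t\,\hat{\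 }\,\underline c_2=s))\bigr)$. 4. The translation with domain $Seq^*(x)$ that sends $a,b$ to $\underline c_1,\underline c_2$, $x*y=z$ to $x\,\hat{\ }\,y=z$, and $Sx=y$ to $(x=\underline c_1\wedge y=\underline c_2)\vee(\neg x=\underline c_1\wedge x\,\hat{\ }\,\underline c_2=y)$ is an interpretation of $QT^+$ in $I\Sigma_0$. -/

import Mathlib

open FirstOrder FirstOrder.Language

namespace ConcatArith

noncomputable section

/-! ### First-order formulas with named free variables -/

section Named

variable {L : FirstOrder.Language.{0, 0}} {α : Type} [DecidableEq α]

/-- `∀ xᵢ φ`, where `xᵢ` is one of the free variables of `φ`. -/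
def allv (i : α) (φ : L.Formula α) : L.Formula α :=
  (BoundedFormula.relabel (fun j => if j = i then Sum.inr (0 : Fin 1) else Sum.inl j) φ :
    L.BoundedFormula α 1).all

/-- `∃ xᵢ φ`, where `xᵢ` is one of the free variables of `φ`. -/
def exv (i : α) (φ : L.Formula α) : L.Formula α :=
  (BoundedFormula.relabel (fun j => if j = i then Sum.inr (0 : Fin 1) else Sum.inl j) φ :
    L.BoundedFormula α 1).ex

/-- `φ[t / xᵢ]`, the (capture-free) substitution of the term `t` for the free variable `xᵢ`. -/
def substv (i : α) (t : L.Term α) (φ : L.Formula α) : L.Formula α :=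
  φ.subst (Function.update Term.var i t)

end Named

/-- The universal closure of a formula. -/
def univClosure {L : FirstOrder.Language.{0, 0}} {k : ℕ} (φ : L.Formula (Fin k)) : L.Sentence :=
  Formula.iAlls (Fin k) (φ.relabel Sum.inr)

/-- A formula made of two terms, `t = u`. -/
infix:88 " ≐ " => Term.equal

/-! ### Relative interpretations

The notion of Tarski, Mostowski and Robinson: quantifiers are relativized to a domain, equality is
kept, and the nonlogical symbols are replaced by formulas. -/

/-- A translation of the language `L` into the language `L'`. -/
structure Translation (L L' : FirstOrder.Language.{0, 0}) where
  /-- The formula `δ(x₀)` that defines the domain. -/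
  dom : L'.Formula (Fin 1)
  /-- The formula `φ_f(x₀, …, xₗ₋₁, y)` that translates `f(x₀, …, xₗ₋₁) = y`; the last variable
  is `y`. -/
  fn : ∀ {l : ℕ}, L.Functions l → L'.Formula (Fin (l + 1))
  /-- The formula `φ_R(x₀, …, xₗ₋₁)` that translates `R(x₀, …, xₗ₋₁)`. -/
  rl : ∀ {l : ℕ}, L.Relations l → L'.Formula (Fin l)

namespace Translation

variable {L L' : FirstOrder.Language.{0, 0}} (τ : Translation L L')

/-- `δ(x)` for a variable `x`. -/
def domAt {γ : Type} (x : γ) : L'.Formula γ :=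
  τ.dom.relabel fun _ => x

/-- The translation of `t = y`, where `y` is the additional variable `Sum.inr ()`:
the translation of `f(t₁, …, tₗ) = y` is
`∃ z₁ … zₗ (⋀ᵢ (δ(zᵢ) ∧ (tᵢ = zᵢ)) ∧ φ_f(z₁, …, zₗ, y))`. -/
def graph {β : Type} : L.Term β → L'.Formula (β ⊕ Unit)
  | .var b => (Term.var (Sum.inl b)) ≐ (Term.var (Sum.inr ()))
  | @Term.func _ _ l f ts =>
      Formula.iExs (Fin l)
        (Formula.iInf (fun i : Fin l =>
            τ.domAt (Sum.inr i) ⊓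
              (graph (ts i)).relabel
                (Sum.elim (fun b => Sum.inl (Sum.inl b)) (fun _ => Sum.inr i))) ⊓
          (τ.fn f).relabel
            (Fin.snoc (α := fun _ => (β ⊕ Unit) ⊕ Fin l) (fun i : Fin l => Sum.inr i)
              (Sum.inl (Sum.inr ()))))

/-- The translation of formulas: atomic formulas are unnested by means of `graph`, connectives are
kept, and quantifiers are relativized to `δ`. -/
def tr {α : Type} : ∀ {n : ℕ}, L.BoundedFormula α n → L'.BoundedFormula α n
  | _, .falsum => .falsum
  | n, .equal t u =>
      BoundedFormula.relabel (n := n) (k := 0) id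
        (Formula.iExs Unit (τ.domAt (Sum.inr ()) ⊓ τ.graph t ⊓ τ.graph u))
  | n, @BoundedFormula.rel _ _ _ l R ts =>
      BoundedFormula.relabel (n := n) (k := 0) id
        (Formula.iExs (Fin l)
          (Formula.iInf (fun i : Fin l =>
              τ.domAt (Sum.inr i) ⊓
                (τ.graph (ts i)).relabel (Sum.elim Sum.inl (fun _ => Sum.inr i))) ⊓
            (τ.rl R).relabel Sum.inr))
  | _, .imp φ ψ => (tr φ).imp (tr ψ)
  | n, .all φ =>
      (BoundedFormula.imp
        (BoundedFormula.relabel (n := n + 1) (k := 0) (fun _ => Sum.inr (Fin.last n)) τ.dom)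
        (tr φ)).all

/-- The domain is nonempty. -/
def domNonempty : L'.Sentence :=
  Formula.iExs Unit (τ.domAt (Sum.inr ()))

/-- The formula `φ_f` defines a function on the domain:
if `δ(x₀), …, δ(xₗ₋₁)` then there is exactly one `y` with `δ(y)` and `φ_f(x₀, …, xₗ₋₁, y)`. -/
def fnTotal {l : ℕ} (f : L.Functions l) : L'.Formula (Fin l) :=
  (Formula.iInf fun i : Fin l => τ.domAt i).imp
    (Formula.iExsUnique Unit
      (τ.domAt (Sum.inr ()) ⊓
        (τ.fn f).relabel
          (Fin.snoc (α := fun _ => Fin l ⊕ Unit) (fun i : Fin l => Sum.inl i) (Sum.inr ()))))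

/-- `τ` is an interpretation of the theory `T` in the theory `T'`: `T'` proves that the domain is
nonempty, that the function symbols are translated into functions on the domain, and the
translations of the axioms of `T`. -/
def IsInterpretation (T : L.Theory) (T' : L'.Theory) : Prop :=
  T' ⊨ᵇ τ.domNonempty ∧
    (∀ (l : ℕ) (f : L.Functions l), T' ⊨ᵇ τ.fnTotal f) ∧
    ∀ φ ∈ T, T' ⊨ᵇ τ.tr φ

end Translation

/-- The theory `T` is (relatively) interpretable in the theory `T'`. -/
def InterpretableIn {L L' : FirstOrder.Language.{0, 0}} (T : L.Theory) (T' : L'.Theory) : Prop :=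
  ∃ τ : Translation L L', τ.IsInterpretation T T'

/-! ### The theory of concatenation `QT⁺` -/

/-- The function symbols of the language of `QT⁺`. -/
inductive StrFunc : ℕ → Type
  | a : StrFunc 0
  | b : StrFunc 0
  | succ : StrFunc 1
  | cat : StrFunc 2

/-- The language `{a, b, S, *}` of `QT⁺`. -/
def strLang : FirstOrder.Language.{0, 0} := ⟨StrFunc, fun _ => Empty⟩

namespace Str

variable {α : Type}

/-- The letter `a`. -/
def a : strLang.Term α := Term.func (L := strLang) StrFunc.a ![]
/-- The letter `b`. -/
def b : strLang.Term α := Term.func (L := strLang) StrFunc.b ![]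
/-- `S t`. -/
def succ (t : strLang.Term α) : strLang.Term α := Term.func (L := strLang) StrFunc.succ ![t]
/-- `t * u`. -/
def cat (t u : strLang.Term α) : strLang.Term α := Term.func (L := strLang) StrFunc.cat ![t, u]

/-- The variable `x`. -/
def x : strLang.Term (Fin 3) := Term.var 0
/-- The variable `y`. -/
def y : strLang.Term (Fin 3) := Term.var 1
/-- The variable `z`. -/
def z : strLang.Term (Fin 3) := Term.var 2

/-- `(x*y)*z = x*(y*z)` -/
def ax1 : strLang.Formula (Fin 3) := cat (cat x y) z ≐ cat x (cat y z)

/-- `¬(x*y = a) ∧ ¬(x*y = b)` -/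
def ax2 : strLang.Formula (Fin 3) := ∼(cat x y ≐ a) ⊓ ∼(cat x y ≐ b)

/-- `(x*a = y*a → x = y) ∧ (x*b = y*b → x = y) ∧ (a*x = a*y → x = y) ∧ (b*x = b*y → x = y)` -/
def ax3 : strLang.Formula (Fin 3) :=
  ((cat x a ≐ cat y a) ⟹ (x ≐ y)) ⊓ ((cat x b ≐ cat y b) ⟹ (x ≐ y)) ⊓
    ((cat a x ≐ cat a y) ⟹ (x ≐ y)) ⊓ ((cat b x ≐ cat b y) ⟹ (x ≐ y))

/-- `¬(a*x = b*y) ∧ ¬(x*a = y*b)` -/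
def ax4 : strLang.Formula (Fin 3) := ∼(cat a x ≐ cat b y) ⊓ ∼(cat x a ≐ cat y b)

/-- `x = a ∨ x = b ∨ (∃y (a*y = x ∨ b*y = x) ∧ ∃z (z*a = x ∨ z*b = x))` -/
def ax5 : strLang.Formula (Fin 3) :=
  (x ≐ a) ⊔ ((x ≐ b) ⊔
    (exv 1 ((cat a y ≐ x) ⊔ (cat b y ≐ x)) ⊓ exv 2 ((cat z a ≐ x) ⊔ (cat z b ≐ x))))

/-- `S x = y ↔ ((x = a ∧ y = b) ∨ (¬ x = a ∧ x*b = y))` -/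
def ax6 : strLang.Formula (Fin 3) :=
  (succ x ≐ y) ⇔ (((x ≐ a) ⊓ (y ≐ b)) ⊔ (∼(x ≐ a) ⊓ (cat x b ≐ y)))

end Str

/-- The theory `QT⁺`, whose axioms are the universal closures of the six formulas above. -/
def QTplus : strLang.Theory :=
  {univClosure Str.ax1, univClosure Str.ax2, univClosure Str.ax3, univClosure Str.ax4, univClosure Str.ax5,
    univClosure Str.ax6}

/-! ### The arithmetical theory `IΣ₀` -/

/-- The function symbols of the language of arithmetic. -/
inductive ArithFunc : ℕ → Type
  | zero : ArithFunc 0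
  | succ : ArithFunc 1
  | add : ArithFunc 2
  | mul : ArithFunc 2

/-- The language `{0, ', +, ·}` of arithmetic. -/
def arith : FirstOrder.Language.{0, 0} := ⟨ArithFunc, fun _ => Empty⟩

/-- The standard model. -/
instance arithNat : arith.Structure ℕ where
  funMap {n} (f : ArithFunc n) :=
    match n, f with
    | _, .zero => fun _ => 0
    | _, .succ => fun v => v 0 + 1
    | _, .add => fun v => v 0 + v 1
    | _, .mul => fun v => v 0 * v 1
  RelMap {_} (r : Empty) := r.elim

namespace Ar

variable {α : Type}

/-- `0` -/
def zero : arith.Term α := Term.func (L := arith) ArithFunc.zero ![]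
/-- `t'` -/
def succ (t : arith.Term α) : arith.Term α := Term.func (L := arith) ArithFunc.succ ![t]
/-- `t + u` -/
def add (t u : arith.Term α) : arith.Term α := Term.func (L := arith) ArithFunc.add ![t, u]
/-- `t · u` -/
def mul (t u : arith.Term α) : arith.Term α := Term.func (L := arith) ArithFunc.mul ![t, u]
/-- The numeral `0'`. -/
def one : arith.Term α := succ zero
/-- The numeral `0''`. -/
def two : arith.Term α := succ (succ zero)

/-- `t ≤ u`, that is, `∃z (z + t = u)`. -/
def le {n : ℕ} (t u : arith.Term (α ⊕ Fin n)) : arith.BoundedFormula α n :=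
  (Term.bdEqual
    (add (Term.var (Sum.inr (Fin.last n))) (t.relabel (Sum.map id Fin.castSucc)))
    (u.relabel (Sum.map id Fin.castSucc))).ex

/-- The bounded formulas: atomic formulas (all of them equations), closed under the connectives and
the bounded quantifiers `∀x (x ≤ t → φ)` and `∃x (x ≤ t ∧ φ)`, where `x` is not in `t`. The
connectives `¬`, `∧`, `∨`, `↔` are made of `→` and `⊥`. -/
inductive IsSigma0 : ∀ {n : ℕ}, arith.BoundedFormula α n → Prop
  | falsum {n : ℕ} : IsSigma0 (BoundedFormula.falsum : arith.BoundedFormula α n)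
  | equal {n : ℕ} (t u : arith.Term (α ⊕ Fin n)) : IsSigma0 (BoundedFormula.equal t u)
  | imp {n : ℕ} {φ ψ : arith.BoundedFormula α n} :
      IsSigma0 φ → IsSigma0 ψ → IsSigma0 (φ.imp ψ)
  | ball {n : ℕ} (t : arith.Term (α ⊕ Fin n)) {φ : arith.BoundedFormula α (n + 1)} :
      IsSigma0 φ →
      IsSigma0 (BoundedFormula.all
        ((le (Term.var (Sum.inr (Fin.last n))) (t.relabel (Sum.map id Fin.castSucc))).imp φ))
  | bex {n : ℕ} (t : arith.Term (α ⊕ Fin n)) {φ : arith.BoundedFormula α (n + 1)} :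
      IsSigma0 φ →
      IsSigma0 (BoundedFormula.ex
        (le (Term.var (Sum.inr (Fin.last n))) (t.relabel (Sum.map id Fin.castSucc)) ⊓ φ))

/-- `t ≤ u` for terms in free variables. -/
def leF (t u : arith.Term α) : arith.Formula α :=
  le (n := 0) (t.relabel Sum.inl) (u.relabel Sum.inl)

/-- The variable `x`. -/
def x : arith.Term (Fin 2) := Term.var 0
/-- The variable `y`. -/
def y : arith.Term (Fin 2) := Term.var 1

/-- The axioms of Robinson arithmetic. -/
def Q : arith.Theory :=
  {univClosure (∼(succ x ≐ zero)),
    univClosure ((succ x ≐ succ y) ⟹ (x ≐ y)),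
    univClosure ((x ≐ zero) ⊔ exv 1 (succ y ≐ x)),
    univClosure (add x zero ≐ x),
    univClosure (add x (succ y) ≐ succ (add x y)),
    univClosure (mul x zero ≐ zero),
    univClosure (mul x (succ y) ≐ add (mul x y) x)}

/-- The induction axiom for `φ` with respect to the variable `xᵢ`, the other variables being
parameters: the universal closure of `φ(0) ∧ ∀x (φ(x) → φ(x')) → ∀x φ(x)`. -/
def ind {k : ℕ} (i : Fin k) (φ : arith.Formula (Fin k)) : arith.Sentence :=
  univClosure ((substv i zero φ ⊓ allv i (φ ⟹ substv i (succ (Term.var i)) φ)) ⟹ allv i φ)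

end Ar

/-- The theory `IΣ₀`: Robinson arithmetic with induction for bounded formulas. -/
def ISigma0 : arith.Theory :=
  Ar.Q ∪ {σ | ∃ (k : ℕ) (i : Fin k) (φ : arith.Formula (Fin k)), Ar.IsSigma0 φ ∧ σ = Ar.ind i φ}

/-! ### Sequence codings in arithmetic -/

/-- The formulas and terms that a coding of sequences consists of (no properties are imposed here). -/
structure SeqCoding where
  /-- `Seq(x₀)`: `x₀` is the code of a sequence of numbers. -/
  seq : arith.Formula (Fin 1)
  /-- `x₀ ∈ x₁`: `x₀` is a term of the sequence coded by `x₁`. -/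
  mem : arith.Formula (Fin 2)
  /-- `x₀ ^ x₁ = x₂`: the graph of the concatenation function on codes. -/
  cat : arith.Formula (Fin 3)
  /-- A term `p(x₀, x₁)`, that is, a polynomial, meant to bound `x₀ ^ x₁`. -/
  bound : arith.Term (Fin 2)
  /-- A variable-free term, meant to be the code of the sequence `⟨1⟩`. -/
  c₁ : arith.Term Empty
  /-- A variable-free term, meant to be the code of the sequence `⟨2⟩`. -/
  c₂ : arith.Term Empty

namespace SeqCoding

variable (C : SeqCoding)

section Formulas

variable {α : Type}

/-- `Seq(t)` -/
def Seq (t : arith.Term α) : arith.Formula α := C.seq.subst ![t]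
/-- `t ∈ u` -/
def Mem (t u : arith.Term α) : arith.Formula α := C.mem.subst ![t, u]
/-- `t ^ u = v` -/
def Cat (t u v : arith.Term α) : arith.Formula α := C.cat.subst ![t, u, v]
/-- `c₁` as a term in any variables. -/
def k₁ : arith.Term α := C.c₁.relabel Empty.elim
/-- `c₂` as a term in any variables. -/
def k₂ : arith.Term α := C.c₂.relabel Empty.elim

end Formulas

/-- `Seq*(x)`, that is, `Seq(x) ∧ ∃y (y ∈ x) ∧ ∀y (y ∈ x → y = 0' ∨ y = 0'')`. -/
def seqStar : arith.Formula (Fin 1) :=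
  C.seq ⊓
    (BoundedFormula.relabel (n := 1) (k := 0) ![Sum.inr 0, Sum.inl 0] C.mem).ex ⊓
    ((BoundedFormula.relabel (n := 1) (k := 0) ![Sum.inr 0, Sum.inl 0] C.mem) ⟹
      ((Term.bdEqual (Term.var (Sum.inr 0)) Ar.one) ⊔
        (Term.bdEqual (Term.var (Sum.inr 0)) Ar.two))).all

/-- `Seq*(t)` -/
def SeqStar {α : Type} (t : arith.Term α) : arith.Formula α := C.seqStar.subst ![t]

/-- In the standard model, the formulas and terms of `C` mean what they are meant to mean:
every finite sequence of numbers has exactly one code, different sequences have different codes,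
`Seq` holds of the codes, `∈` says that a number is a term of the sequence with the given code,
`^` is the concatenation, and `c₁`, `c₂` denote the codes of `⟨1⟩` and `⟨2⟩`. -/
def IsStandard : Prop :=
  ∃ code : List ℕ → ℕ, Function.Injective code ∧
    (∀ n : ℕ, C.seq.Realize ![n] ↔ ∃ l, code l = n) ∧
    (∀ (n : ℕ) (l : List ℕ), C.mem.Realize ![n, code l] ↔ n ∈ l) ∧
    (∀ (l m : List ℕ) (n : ℕ), C.cat.Realize ![code l, code m, n] ↔ n = code (l ++ m)) ∧
    C.c₁.realize (Empty.elim : Empty → ℕ) = code [1] ∧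
    C.c₂.realize (Empty.elim : Empty → ℕ) = code [2]

/-- The variable `s`. -/
def s : arith.Term (Fin 6) := Term.var 0
/-- The variable `t`. -/
def t : arith.Term (Fin 6) := Term.var 1
/-- The variable `u`. -/
def u : arith.Term (Fin 6) := Term.var 2
/-- The variable `p`. -/
def p : arith.Term (Fin 6) := Term.var 3
/-- The variable `q`. -/
def q : arith.Term (Fin 6) := Term.var 4
/-- The variable `r`. -/
def r : arith.Term (Fin 6) := Term.var 5

/-- `^` is a total function: `∃u (s ^ t = u ∧ ∀p (s ^ t = p → p = u))`. -/
def catTotal : arith.Formula (Fin 6) :=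
  exv 2 (C.Cat s t u ⊓ allv 3 (C.Cat s t p ⟹ (p ≐ u)))

/-- `^` is bounded by the polynomial: `s ^ t = u → u ≤ bound(s, t)`. -/
def catBounded : arith.Formula (Fin 6) :=
  C.Cat s t u ⟹ Ar.leF u (C.bound.subst ![s, t])

/-- `^` is `0` outside the codes: `¬(Seq(s) ∧ Seq(t)) → s ^ t = 0`. -/
def catJunk : arith.Formula (Fin 6) :=
  ∼(C.Seq s ⊓ C.Seq t) ⟹ C.Cat s t Ar.zero

/-- `v₁ ^ v₂ = w₁ ^ w₂`, for terms without the variable `p`: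
`∃p (v₁ ^ v₂ = p ∧ w₁ ^ w₂ = p)`. -/
def SameCat (v₁ v₂ w₁ w₂ : arith.Term (Fin 6)) : arith.Formula (Fin 6) :=
  exv 3 (C.Cat v₁ v₂ p ⊓ C.Cat w₁ w₂ p)

/-- `v` codes a sequence of length one whose term is `c`, for terms without the variables `p`, `q`:
`Seq*(v) ∧ ∀p (p ∈ v ↔ p = c) ∧ ¬∃p ∃q (Seq*(p) ∧ Seq*(q) ∧ p ^ q = v)`.
The last clause says that the sequence is not the concatenation of two nonempty ones. -/
def Single (v c : arith.Term (Fin 6)) : arith.Formula (Fin 6) :=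
  C.SeqStar v ⊓ allv 3 (C.Mem p v ⇔ (p ≐ c)) ⊓
    ∼(exv 3 (exv 4 (C.SeqStar p ⊓ C.SeqStar q ⊓ C.Cat p q v)))

/-- `∃s Seq*(s)` -/
def t0 : arith.Formula (Fin 6) := exv 0 (C.SeqStar s)

/-- There is exactly one code `s` of the one-term sequence with term `1`, and it is `c₁`. -/
def t1 : arith.Formula (Fin 6) :=
  exv 0 (C.Single s Ar.one ⊓ allv 1 (C.Single t Ar.one ⟹ (t ≐ s))) ⊓ C.Single C.k₁ Ar.one

/-- There is exactly one code `s` of the one-term sequence with term `2`, and it is `c₂`. -/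
def t2 : arith.Formula (Fin 6) :=
  exv 0 (C.Single s Ar.two ⊓ allv 1 (C.Single t Ar.two ⟹ (t ≐ s))) ⊓ C.Single C.k₂ Ar.two

/-- `Seq*(s) ∧ Seq*(t) → ∃!u (Seq*(u) ∧ s ^ t = u)` -/
def t3 : arith.Formula (Fin 6) :=
  (C.SeqStar s ⊓ C.SeqStar t) ⟹
    exv 2 (C.SeqStar u ⊓ C.Cat s t u ⊓ allv 3 ((C.SeqStar p ⊓ C.Cat s t p) ⟹ (p ≐ u)))

/-- `Seq*(s) ∧ Seq*(t) ∧ Seq*(u) → (s ^ t) ^ u = s ^ (t ^ u)`; here `p = s ^ t`, `q = t ^ u`, and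
`r` is the common value. -/
def t4 : arith.Formula (Fin 6) :=
  (C.SeqStar s ⊓ C.SeqStar t ⊓ C.SeqStar u) ⟹
    exv 3 (exv 4 (exv 5 (C.Cat s t p ⊓ C.Cat p u r ⊓ C.Cat t u q ⊓ C.Cat s q r)))

/-- `Seq*(s) ∧ Seq*(t) → ¬(s ^ t = c₁) ∧ ¬(s ^ t = c₂)` -/
def t5 : arith.Formula (Fin 6) :=
  (C.SeqStar s ⊓ C.SeqStar t) ⟹ (∼(C.Cat s t C.k₁) ⊓ ∼(C.Cat s t C.k₂))

/-- `Seq*(s) ∧ Seq*(t) → (c₁ ^ s = c₁ ^ t → s = t) ∧ (c₂ ^ s = c₂ ^ t → s = t)` -/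
def t6 : arith.Formula (Fin 6) :=
  (C.SeqStar s ⊓ C.SeqStar t) ⟹
    ((C.SameCat C.k₁ s C.k₁ t ⟹ (s ≐ t)) ⊓ (C.SameCat C.k₂ s C.k₂ t ⟹ (s ≐ t)))

/-- `Seq*(s) ∧ Seq*(t) → (s ^ c₁ = t ^ c₁ → s = t) ∧ (s ^ c₂ = t ^ c₂ → s = t)` -/
def t7 : arith.Formula (Fin 6) :=
  (C.SeqStar s ⊓ C.SeqStar t) ⟹
    ((C.SameCat s C.k₁ t C.k₁ ⟹ (s ≐ t)) ⊓ (C.SameCat s C.k₂ t C.k₂ ⟹ (s ≐ t)))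

/-- `Seq*(s) ∧ Seq*(t) → ¬(c₁ ^ s = c₂ ^ t) ∧ ¬(s ^ c₁ = t ^ c₂)` -/
def t8 : arith.Formula (Fin 6) :=
  (C.SeqStar s ⊓ C.SeqStar t) ⟹
    (∼(C.SameCat C.k₁ s C.k₂ t) ⊓ ∼(C.SameCat s C.k₁ t C.k₂))

/-- `Seq*(s) → s = c₁ ∨ s = c₂ ∨ (∃t (Seq*(t) ∧ (c₁ ^ t = s ∨ c₂ ^ t = s)) ∧
∃t (Seq*(t) ∧ (t ^ c₁ = s ∨ t ^ c₂ = s)))` -/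
def t9 : arith.Formula (Fin 6) :=
  C.SeqStar s ⟹
    ((s ≐ C.k₁) ⊔ ((s ≐ C.k₂) ⊔
      (exv 1 (C.SeqStar t ⊓ (C.Cat C.k₁ t s ⊔ C.Cat C.k₂ t s)) ⊓
        exv 1 (C.SeqStar t ⊓ (C.Cat t C.k₁ s ⊔ C.Cat t C.k₂ s)))))

/-- The translation of the language of `QT⁺` determined by `C`: strings are the `x` with `Seq*(x)`,
the letters `a`, `b` are `c₁`, `c₂`, and `x * y` is `x ^ y`. The formula for `S x = y` is
`(x = c₁ ∧ y = c₂) ∨ (¬ x = c₁ ∧ x ^ c₂ = y)`. -/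
def translation : Translation strLang arith where
  dom := C.seqStar
  fn {l} (f : StrFunc l) :=
    match l, f with
    | _, .a => (Term.var 0) ≐ C.k₁
    | _, .b => (Term.var 0) ≐ C.k₂
    | _, .succ =>
        (((Term.var 0) ≐ C.k₁) ⊓ ((Term.var 1) ≐ C.k₂)) ⊔
          (∼((Term.var 0) ≐ C.k₁) ⊓ C.Cat (Term.var 0) C.k₂ (Term.var 1))
    | _, .cat => C.cat
  rl {_} (R : Empty) := R.elim

end SeqCoding

end

end ConcatArith

open ConcatArith

namespace ConcatArith

set_option linter.unusedSectionVars false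
set_option synthInstance.maxSize 2000
set_option synthInstance.maxHeartbeats 200000

/-! ### Bounded formulas and definability -/

namespace Ar

/-! A number is read as the binary string of its expansion without leading zeros, with `0` as the
empty string. Let `len y` be the least power of two above `y`; then `cat x y = x * len y + y`
concatenates strings. Since `len y ≤ 2 * y + 1`, all of this is polynomially bounded, and no
exponentiation is needed.

Codes of sequences are the strings of even length, that is, those for which `len x` is the square of
a power of two. They are closed under concatenation. The irreducible codes ("blocks") are the
strings `1 d₁ 0 d₂ … 0 dₖ`; such a block codes `⟨n⟩` when `1 d₁ … dₖ` is the binary expansion of `n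
+ 2`. So `⟨0⟩`, `⟨1⟩`, `⟨2⟩` have the codes `2`, `3`, `8`. A term of a sequence is a number coded by
a block factor.

No length of a sequence and no list of its terms has to be defined inside the theory.
Equidivisibility of strings (`exists_cat_eq`, `levi`) replaces counting: with irreducibility it
gives the terms of a concatenation (`mem_cat`) and the uniqueness of the first and last block.
Strong induction shows that every nonempty code begins and ends with a block. `IsBlock.cases` and
`codes_four_mul_iff` describe blocks by recursion on their last two digits and show that `3` and `8`
are the only blocks that code `1` and `2`.

On the logical side, the argument takes place in an arbitrary model, which is first turned into an
ordered semiring (`exists_sigma0Model`, `Sigma0Model.exists_orderedSemiring`). Instance search on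
`Sigma0Def` certifies that predicates are bounded formulas; this yields both the instances of
induction (`sigma0_induction`) and the formulas of the coding. Finally
`Translation.Defines.realize_tr` reduces the interpretation to the fact that the strings of a model
satisfy `QTplus`. -/

theorem add_subst {α β : Type} (t u : arith.Term α) (f : α → arith.Term β) :
    (add t u).subst f = add (t.subst f) (u.subst f) := by
  simp only [add, Term.subst]
  congr 1
  funext i
  fin_cases i <;> rfl

/-- Substitution commutes with weakening the bounding term under a quantifier, so bounded
quantifiers keep their form. This permits renaming the parameters of a formula by `Fin k`, as the
induction axioms require. -/
theorem IsSigma0.subst {α β : Type} (f : α → arith.Term β) {n : ℕ} {φ : arith.BoundedFormula α n}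
    (h : IsSigma0 φ) : IsSigma0 (φ.subst f) := by
  have key : ∀ {n : ℕ} (t : arith.Term (α ⊕ Fin n)),
      (t.relabel (Sum.map id Fin.castSucc)).subst
          (Sum.elim (Term.relabel Sum.inl ∘ f) (Term.var ∘ Sum.inr)) =
        ((t.subst (Sum.elim (Term.relabel Sum.inl ∘ f) (Term.var ∘ Sum.inr))).relabel
          (Sum.map id Fin.castSucc) : arith.Term (β ⊕ Fin (n + 1))) := by
    intro n t
    induction t with
    | var a =>
      cases a with
      | inl a =>
        simp only [Term.relabel, Term.subst, Sum.map_inl, Sum.elim_inl, Function.comp_apply,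
          Term.relabel_relabel]
        rfl
      | inr a => rfl
    | func g ts ih =>
      simp only [Term.relabel, Term.subst]
      exact congrArg _ (funext ih)
  have key_le : ∀ {n : ℕ} (t : arith.Term (α ⊕ Fin n)),
      (le (Term.var (Sum.inr (Fin.last n))) (t.relabel (Sum.map id Fin.castSucc))).subst f =
        le (Term.var (Sum.inr (Fin.last n)))
          ((t.subst (Sum.elim (Term.relabel Sum.inl ∘ f) (Term.var ∘ Sum.inr))).relabel
            (Sum.map id Fin.castSucc)) := by
    intro n t
    simp only [le, BoundedFormula.subst, BoundedFormula.mapTermRel, BoundedFormula.ex,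
      BoundedFormula.not, Term.bdEqual, ← key, add_subst]
    rfl
  induction h with
  | falsum => exact .falsum
  | equal t u => exact .equal _ _
  | imp _ _ h₁ h₂ => exact .imp h₁ h₂
  | ball t _ h =>
    have := IsSigma0.ball (t.subst (Sum.elim (Term.relabel Sum.inl ∘ f) (Term.var ∘ Sum.inr))) h
    rw [← key_le] at this
    exact this
  | bex t _ h =>
    have := IsSigma0.bex (t.subst (Sum.elim (Term.relabel Sum.inl ∘ f) (Term.var ∘ Sum.inr))) h
    rw [← key_le] at this
    exact this

end Ar

/-- Models of `IΣ₀` in terms of operations `0, 1, +, ·, ≤` on the carrier. -/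
class Sigma0Model (M : Type) [Zero M] [One M] [Add M] [Mul M] [LE M] [arith.Structure M] :
    Prop where
  funMap_zero (v : Fin 0 → M) : Structure.funMap (L := arith) ArithFunc.zero v = 0
  funMap_succ (v : Fin 1 → M) : Structure.funMap (L := arith) ArithFunc.succ v = v 0 + 1
  funMap_add (v : Fin 2 → M) : Structure.funMap (L := arith) ArithFunc.add v = v 0 + v 1
  funMap_mul (v : Fin 2 → M) : Structure.funMap (L := arith) ArithFunc.mul v = v 0 * v 1
  le_def (x y : M) : x ≤ y ↔ ∃ z, z + x = y
  add_one_ne_zero' (x : M) : x + 1 ≠ 0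
  add_one_inj' {x y : M} : x + 1 = y + 1 → x = y
  exists_add_one' (x : M) : x = 0 ∨ ∃ y, y + 1 = x
  add_zero' (x : M) : x + 0 = x
  add_add_one' (x y : M) : x + (y + 1) = x + y + 1
  mul_zero' (x : M) : x * 0 = 0
  mul_add_one' (x y : M) : x * (y + 1) = x * y + x
  one_def : (1 : M) = 0 + 1
  ind {k : ℕ} (i : Fin k) (φ : arith.Formula (Fin k)) : Ar.IsSigma0 φ → ∀ v : Fin k → M,
    φ.Realize (Function.update v i 0) →
    (∀ x, φ.Realize (Function.update v i x) → φ.Realize (Function.update v i (x + 1))) →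
    ∀ x, φ.Realize (Function.update v i x)

section Realize

variable {M : Type} [Zero M] [One M] [Add M] [Mul M] [LE M] [arith.Structure M] [Sigma0Model M]
variable {α : Type} (v : α → M)

@[simp] theorem realize_zero : (Ar.zero : arith.Term α).realize v = 0 :=
  Sigma0Model.funMap_zero _

@[simp] theorem realize_succ (t : arith.Term α) :
    (Ar.succ t).realize v = t.realize v + 1 := Sigma0Model.funMap_succ _

@[simp] theorem realize_add (t u : arith.Term α) :
    (Ar.add t u).realize v = t.realize v + u.realize v := Sigma0Model.funMap_add _

@[simp] theorem realize_mul (t u : arith.Term α) :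
    (Ar.mul t u).realize v = t.realize v * u.realize v := Sigma0Model.funMap_mul _

@[simp] theorem realize_one : (Ar.one : arith.Term α).realize v = 1 := by
  rw [Ar.one, realize_succ, realize_zero]
  exact Sigma0Model.one_def.symm

@[simp] theorem realize_two : (Ar.two : arith.Term α).realize v = 1 + 1 := by
  have h := realize_one (M := M) v
  rw [Ar.one] at h
  rw [Ar.two, realize_succ, h]

@[simp] theorem realize_le {n : ℕ} (w : Fin n → M) (t u : arith.Term (α ⊕ Fin n)) :
    (Ar.le t u).Realize v w ↔ t.realize (Sum.elim v w) ≤ u.realize (Sum.elim v w) := by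
  have h : ∀ a, Sum.elim v (Fin.snoc w a : Fin (n + 1) → M) ∘ Sum.map id Fin.castSucc =
      Sum.elim v w := by
    intro a
    funext x
    cases x <;> simp
  simp [Ar.le, Sigma0Model.le_def, h]

end Realize

section Definability

variable {ι : Type*} {S : ι → Type} [∀ i, Zero (S i)] [∀ i, One (S i)] [∀ i, Add (S i)]
  [∀ i, Mul (S i)] [∀ i, LE (S i)] [∀ i, arith.Structure (S i)] [∀ i, Sigma0Model (S i)]
  {α : Type}

/-- A family of functions on a family of structures that is given by one term. -/
class TermDef (env : ∀ i, α → S i) {n : ℕ} (f : ∀ i, (Fin n → S i) → S i) : Prop where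
  exists_term : ∃ t : arith.Term (α ⊕ Fin n), ∀ i v, t.realize (Sum.elim (env i) v) = f i v

/-- A family of relations on a family of structures that is given by one bounded formula. -/
class Sigma0Def (env : ∀ i, α → S i) {n : ℕ} (P : ∀ i, (Fin n → S i) → Prop) : Prop where
  exists_formula : ∃ φ : arith.BoundedFormula α n, Ar.IsSigma0 φ ∧
    ∀ i v, φ.Realize (env i) v ↔ P i v

variable {env : ∀ i, α → S i} {n : ℕ}

namespace TermDef

variable {f g : ∀ i, (Fin n → S i) → S i}

instance free (a : α) : TermDef env (fun i (_ : Fin n → S i) => env i a) :=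
  ⟨⟨Term.var (Sum.inl a), fun _ _ => rfl⟩⟩

instance bound (j : Fin n) : TermDef env (fun i (v : Fin n → S i) => v j) :=
  ⟨⟨Term.var (Sum.inr j), fun _ _ => rfl⟩⟩

instance zero : TermDef env (fun i (_ : Fin n → S i) => 0) :=
  ⟨⟨Ar.zero, fun _ _ => realize_zero _⟩⟩

instance one : TermDef env (fun i (_ : Fin n → S i) => 1) :=
  ⟨⟨Ar.one, fun _ _ => realize_one _⟩⟩

instance add [hf : TermDef env f] [hg : TermDef env g] :
    TermDef env (fun i v => f i v + g i v) := by
  obtain ⟨t, ht⟩ := hf.exists_term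
  obtain ⟨u, hu⟩ := hg.exists_term
  exact ⟨⟨Ar.add t u, fun i v => by rw [realize_add, ht, hu]⟩⟩

instance mul [hf : TermDef env f] [hg : TermDef env g] :
    TermDef env (fun i v => f i v * g i v) := by
  obtain ⟨t, ht⟩ := hf.exists_term
  obtain ⟨u, hu⟩ := hg.exists_term
  exact ⟨⟨Ar.mul t u, fun i v => by rw [realize_mul, ht, hu]⟩⟩

end TermDef

namespace Sigma0Def

variable {f g : ∀ i, (Fin n → S i) → S i} {P Q : ∀ i, (Fin n → S i) → Prop}

theorem congr (h : ∀ i v, P i v ↔ Q i v) (hP : Sigma0Def env P) : Sigma0Def env Q := by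
  obtain ⟨φ, h₁, h₂⟩ := hP.exists_formula
  exact ⟨⟨φ, h₁, fun i v => (h₂ i v).trans (h i v)⟩⟩

instance eq [hf : TermDef env f] [hg : TermDef env g] :
    Sigma0Def env (fun i v => f i v = g i v) := by
  obtain ⟨t, ht⟩ := hf.exists_term
  obtain ⟨u, hu⟩ := hg.exists_term
  exact ⟨⟨_, .equal t u, fun i v => by rw [BoundedFormula.Realize, ht, hu]⟩⟩

instance imp [hP : Sigma0Def env P] [hQ : Sigma0Def env Q] :
    Sigma0Def env (fun i v => P i v → Q i v) := by
  obtain ⟨φ, h₁, h₂⟩ := hP.exists_formula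
  obtain ⟨ψ, h₃, h₄⟩ := hQ.exists_formula
  exact ⟨⟨_, .imp h₁ h₃, fun i v => by rw [BoundedFormula.realize_imp, h₂, h₄]⟩⟩

instance not [hP : Sigma0Def env P] : Sigma0Def env (fun i v => ¬ P i v) :=
  imp (hQ := ⟨⟨_, .falsum, fun _ _ => Iff.rfl⟩⟩)

instance and [hP : Sigma0Def env P] [hQ : Sigma0Def env Q] :
    Sigma0Def env (fun i v => P i v ∧ Q i v) :=
  congr (P := fun i v => ¬ (P i v → ¬ Q i v)) (fun _ _ => by tauto) inferInstance

instance or [hP : Sigma0Def env P] [hQ : Sigma0Def env Q] :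
    Sigma0Def env (fun i v => P i v ∨ Q i v) :=
  congr (P := fun i v => ¬ P i v → Q i v) (fun _ _ => by tauto) inferInstance

instance iff [hP : Sigma0Def env P] [hQ : Sigma0Def env Q] :
    Sigma0Def env (fun i v => P i v ↔ Q i v) :=
  congr (P := fun i v => (P i v → Q i v) ∧ (Q i v → P i v)) (fun _ _ => by tauto) inferInstance

/-- The quantified variable is the last coordinate of `w`; with the hypothesis in this form,
instance search can descend below the quantifier. -/
instance ball {R : ∀ i, (Fin n → S i) → S i → Prop} [hf : TermDef env f]
    [hR : Sigma0Def env (fun i (w : Fin (n + 1) → S i) =>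
      R i (fun j => w j.castSucc) (w (Fin.last n)))] :
    Sigma0Def env (fun i v => ∀ y ≤ f i v, R i v y) := by
  obtain ⟨t, ht⟩ := hf.exists_term
  obtain ⟨φ, h₁, h₂⟩ := hR.exists_formula
  refine ⟨⟨_, .ball t h₁, fun i v => ?_⟩⟩
  have h : ∀ a, Sum.elim (env i) (Fin.snoc v a : Fin (n + 1) → S i) ∘ Sum.map id Fin.castSucc =
      Sum.elim (env i) v := by
    intro a
    funext x
    cases x <;> simp
  simp [h₂, h, ht]

instance bex {R : ∀ i, (Fin n → S i) → S i → Prop} [hf : TermDef env f]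
    [hR : Sigma0Def env (fun i (w : Fin (n + 1) → S i) =>
      R i (fun j => w j.castSucc) (w (Fin.last n)))] :
    Sigma0Def env (fun i v => ∃ y ≤ f i v, R i v y) :=
  congr (fun i v => by push Not; rfl) (not (hP := ball (R := fun i v y => ¬ R i v y)))

/-- The formula that `≤` abbreviates has an unbounded quantifier, so it is replaced by the bounded
`∃ y ≤ g, y = f`. -/
instance le [hf : TermDef env f] [hg : TermDef env g] :
    Sigma0Def env (fun i v => f i v ≤ g i v) := by
  have : TermDef env (fun i (w : Fin (n + 1) → S i) => f i (fun j => w j.castSucc)) := by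
    obtain ⟨t, ht⟩ := hf.exists_term
    refine ⟨⟨t.relabel (Sum.map id Fin.castSucc), fun i v => ?_⟩⟩
    rw [Term.realize_relabel]
    refine Eq.trans ?_ (ht i _)
    congr 1
    funext x
    cases x <;> simp
  refine congr ?_ (bex (f := g) (R := fun i v y => y = f i v))
  intro i v
  simp

end Sigma0Def

end Definability

/-! ### Induction for bounded predicates with parameters -/

section Induction

variable {M : Type} [Zero M] [One M] [Add M] [Mul M] [LE M] [arith.Structure M] [Sigma0Model M]

/-- Predicates of a model that are defined by bounded formulas with parameters; the variables of
the formula are an induction variable `none` and the elements of the model. -/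
abbrev Sigma0Pred {n : ℕ} (P : M → (Fin n → M) → Prop) : Prop :=
  Sigma0Def (S := fun _ : M => M) (fun x (o : Option M) => o.elim x id) P

/-- Functions of a model that are defined by terms with parameters. -/
abbrev TermFun {n : ℕ} (f : M → (Fin n → M) → M) : Prop :=
  TermDef (S := fun _ : M => M) (fun x (o : Option M) => o.elim x id) f

instance TermFun.self {n : ℕ} : TermFun (fun (x : M) (_ : Fin n → M) => x) :=
  TermDef.free (S := fun _ : M => M) (env := fun x (o : Option M) => o.elim x id) none

instance TermFun.param {n : ℕ} (a : M) : TermFun (fun (_ : M) (_ : Fin n → M) => a) :=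
  TermDef.free (S := fun _ : M => M) (env := fun x (o : Option M) => o.elim x id) (some a)

theorem realize_congr_of_freeVar {L : FirstOrder.Language.{0, 0}} {N α : Type} [L.Structure N]
    [DecidableEq α] {n : ℕ} (φ : L.BoundedFormula α n) {v w : α → N} (xs : Fin n → N)
    (h : ∀ a ∈ φ.freeVarFinset, v a = w a) : φ.Realize v xs ↔ φ.Realize w xs := by
  rw [← BoundedFormula.realize_restrictFreeVar' (s := φ.freeVarFinset) subset_rfl (v := v),
    ← BoundedFormula.realize_restrictFreeVar' (s := φ.freeVarFinset) subset_rfl (v := w)]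
  have : v ∘ ((↑) : ((φ.freeVarFinset : Finset α) : Set α) → α) = w ∘ (↑) := funext fun a => h a a.2
  rw [this]

/-- Only finitely many elements of the model occur as parameters. Renaming them by `Fin k` gives a
formula to which the induction axiom applies. -/
theorem sigma0_induction {P : M → Prop} [hP : Sigma0Pred (fun x (_ : Fin 0 → M) => P x)]
    (h0 : P 0) (hs : ∀ x, P x → P (x + 1)) (x : M) : P x := by
  classical
  obtain ⟨φ, h₁, h₂⟩ := hP.exists_formula
  -- The induction variable needs an index even if it does not occur in the formula.
  let T := insert none φ.freeVarFinset
  have hn : none ∈ T := Finset.mem_insert_self _ _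
  let e : T ≃ Fin T.card := T.equivFin
  -- Variables outside `T` do not occur in the formula, so their common default index is harmless.
  -- The value `0` that `v` gives to `none` is always overwritten.
  let g : Option M → Fin T.card := fun o => if h : o ∈ T then e ⟨o, h⟩ else e ⟨none, hn⟩
  let v : Fin T.card → M := fun j => (e.symm j).1.elim 0 id
  have key : ∀ x, BoundedFormula.Realize (φ.subst (fun o => Term.var (g o)))
      (Function.update v (e ⟨none, hn⟩) x) default ↔ P x := by
    intro x
    rw [BoundedFormula.realize_subst]
    refine Iff.trans ?_ (h₂ x default)
    refine realize_congr_of_freeVar _ _ fun o ho => ?_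
    have hT : o ∈ T := Finset.mem_insert_of_mem ho
    simp only [Term.realize_var, g, dif_pos hT]
    cases o with
    | none => simp
    | some a =>
      rw [Function.update_of_ne (by simp)]
      simp [v]
  exact (key x).1 (Sigma0Model.ind (e ⟨none, hn⟩) (φ.subst (fun o => Term.var (g o))) (h₁.subst _) v
    ((key 0).2 h0) (fun x h => (key (x + 1)).2 (hs x ((key x).1 h))) x)

end Induction

/-! ### Models of `IΣ₀` are ordered semirings -/

section Raw

namespace Sigma0Model

variable {M : Type} [Zero M] [One M] [Add M] [Mul M] [LE M] [arith.Structure M] [Sigma0Model M]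

theorem zero_add' (x : M) : 0 + x = x := by
  refine sigma0_induction (P := fun x : M => 0 + x = x) (add_zero' 0) (fun x h => ?_) x
  rw [add_add_one', h]

theorem add_one_add (x y : M) : x + 1 + y = x + y + 1 := by
  refine sigma0_induction (P := fun y : M => x + 1 + y = x + y + 1) ?_ (fun y h => ?_) y
  · rw [add_zero', add_zero']
  · rw [add_add_one', h, add_add_one']

theorem add_comm' (x y : M) : x + y = y + x := by
  refine sigma0_induction (P := fun y : M => x + y = y + x) ?_ (fun y h => ?_) y
  · rw [add_zero', zero_add']
  · rw [add_add_one', h, add_one_add]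

theorem add_assoc' (x y z : M) : x + y + z = x + (y + z) := by
  refine sigma0_induction (P := fun z : M => x + y + z = x + (y + z)) ?_
    (fun z h => ?_) z
  · rw [add_zero', add_zero']
  · rw [add_add_one', h, add_add_one', add_add_one']

theorem add_right_cancel' {x y : M} (z : M) : x + z = y + z → x = y := by
  refine sigma0_induction (P := fun z : M => x + z = y + z → x = y) ?_ (fun z h => ?_) z
  · rw [add_zero', add_zero']
    exact id
  · rw [add_add_one', add_add_one']
    exact fun h' => h (add_one_inj' h')

theorem zero_mul' (x : M) : 0 * x = 0 := by
  refine sigma0_induction (P := fun x : M => 0 * x = 0) (mul_zero' 0) (fun x h => ?_) x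
  rw [mul_add_one', h, add_zero']

theorem add_one_mul' (x y : M) : (x + 1) * y = x * y + y := by
  refine sigma0_induction (P := fun y : M => (x + 1) * y = x * y + y) ?_
    (fun y h => ?_) y
  · rw [mul_zero', mul_zero', add_zero']
  · rw [mul_add_one', h, mul_add_one', add_add_one', add_add_one',
      add_assoc' (x * y) y x, add_assoc' (x * y) x y, add_comm' y x]

theorem mul_comm' (x y : M) : x * y = y * x := by
  refine sigma0_induction (P := fun y : M => x * y = y * x) ?_ (fun y h => ?_) y
  · rw [mul_zero', zero_mul']
  · rw [mul_add_one', h, add_one_mul']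

theorem mul_add' (x y z : M) : x * (y + z) = x * y + x * z := by
  refine sigma0_induction (P := fun z : M => x * (y + z) = x * y + x * z) ?_
    (fun z h => ?_) z
  · rw [add_zero', mul_zero', add_zero']
  · rw [add_add_one', mul_add_one', h, mul_add_one', add_assoc']

theorem mul_assoc' (x y z : M) : x * y * z = x * (y * z) := by
  refine sigma0_induction (P := fun z : M => x * y * z = x * (y * z)) ?_
    (fun z h => ?_) z
  · rw [mul_zero', mul_zero', mul_zero']
  · rw [mul_add_one', h, mul_add_one', mul_add']

theorem mul_one' (x : M) : x * 1 = x := by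
  rw [one_def, mul_add_one', mul_zero', zero_add']

theorem eq_zero_of_add {x y : M} (h : x + y = 0) : y = 0 := by
  rcases exists_add_one' y with hy | ⟨z, rfl⟩
  · exact hy
  · rw [add_add_one'] at h
    exact absurd h (add_one_ne_zero' _)

theorem le_refl' (x : M) : x ≤ x := (le_def x x).2 ⟨0, zero_add' x⟩

theorem le_trans' {x y z : M} (h₁ : x ≤ y) (h₂ : y ≤ z) : x ≤ z := by
  obtain ⟨a, rfl⟩ := (le_def x y).1 h₁
  obtain ⟨b, rfl⟩ := (le_def _ z).1 h₂
  exact (le_def _ _).2 ⟨b + a, add_assoc' _ _ _⟩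

theorem le_antisymm' {x y : M} (h₁ : x ≤ y) (h₂ : y ≤ x) : x = y := by
  obtain ⟨a, rfl⟩ := (le_def x y).1 h₁
  obtain ⟨b, h⟩ := (le_def _ x).1 h₂
  have : b + a = 0 := by
    apply add_right_cancel' x
    rw [add_assoc', h, zero_add']
  rw [eq_zero_of_add this, zero_add']

theorem le_total' (x y : M) : x ≤ y ∨ y ≤ x := by
  refine sigma0_induction (P := fun x : M => x ≤ y ∨ y ≤ x) ?_ (fun x h => ?_) x
  · exact .inl ((le_def _ _).2 ⟨y, add_zero' y⟩)
  · rcases h with h | h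
    · obtain ⟨a, rfl⟩ := (le_def _ _).1 h
      rcases exists_add_one' a with rfl | ⟨b, rfl⟩
      · right
        rw [zero_add']
        exact (le_def _ _).2 ⟨1, add_comm' _ _⟩
      · left
        exact (le_def _ _).2 ⟨b, by rw [add_add_one', add_one_add]⟩
    · right
      exact le_trans' h ((le_def _ _).2 ⟨1, add_comm' _ _⟩)

/-- The operations of an ordered semiring on a model agree with those of the model. -/
structure _root_.ConcatArith.OrderedModel (M : Type) [CommSemiring M] [LinearOrder M]
    [arith.Structure M] : Prop where
  strict : IsStrictOrderedRing M
  canonical : CanonicallyOrderedAdd M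
  model : Sigma0Model M

/-- The operations are unchanged, so the model property carries over definitionally. Monotonicity
comes from `le_def`, strictness from additive cancellation. -/
theorem exists_orderedSemiring (M : Type) [Zero M] [One M] [Add M] [Mul M] [LE M]
    [arith.Structure M] [Sigma0Model M] :
    ∃ (_ : CommSemiring M) (_ : LinearOrder M), OrderedModel M := by
  let R : CommSemiring M :=
    { add_assoc := add_assoc'
      zero_add := zero_add'
      add_zero := add_zero'
      add_comm := add_comm'
      left_distrib := mul_add'
      right_distrib := fun x y z => by rw [mul_comm', mul_add', mul_comm' z, mul_comm' z]
      zero_mul := zero_mul'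
      mul_zero := mul_zero'
      mul_assoc := mul_assoc'
      one_mul := fun x => by rw [mul_comm', mul_one']
      mul_one := mul_one'
      mul_comm := mul_comm'
      nsmul := nsmulRec
      npow := npowRec }
  let O : LinearOrder M :=
    { le_refl := le_refl'
      le_trans := fun _ _ _ => le_trans'
      le_antisymm := fun _ _ => le_antisymm'
      le_total := le_total'
      toDecidableLE := Classical.decRel _ }
  have hs : Sigma0Model M := inferInstanceAs (Sigma0Model M)
  have le_iff : ∀ x y : M, x ≤ y ↔ ∃ z, z + x = y := le_def
  have cancel : ∀ x y z : M, x + z = y + z → x = y := fun x y z => add_right_cancel' z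
  have ne : ∀ x : M, x + 1 ≠ 0 := add_one_ne_zero'
  have pred : ∀ x : M, x = 0 ∨ ∃ y, y + 1 = x := exists_add_one'
  have hm : IsOrderedCancelAddMonoid M :=
    { add_le_add_left := fun a b h c => by
        obtain ⟨z, rfl⟩ := (le_iff _ _).1 h
        exact (le_iff _ _).2 ⟨z, by ring⟩
      le_of_add_le_add_left := fun a b c h => by
        obtain ⟨z, hz⟩ := (le_iff _ _).1 h
        exact (le_iff _ _).2 ⟨z, cancel _ _ a (by rw [add_comm c a, ← hz]; ring)⟩ }
  have hc : CanonicallyOrderedAdd M :=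
    { le_self_add := fun a b => (le_iff _ _).2 ⟨b, add_comm _ _⟩
      le_add_self := fun a b => (le_iff _ _).2 ⟨b, rfl⟩
      exists_add_of_le := fun {a b} h => by
        obtain ⟨z, rfl⟩ := (le_iff _ _).1 h
        exact ⟨z, add_comm _ _⟩ }
  have hn : Nontrivial M := ⟨⟨0, 1, fun h => ne 0 (by rw [zero_add, ← h])⟩⟩
  have hp : ∀ a b : M, 0 < a → 0 < b → 0 < a * b := by
    intro a b ha hb
    rcases pred a with rfl | ⟨x, rfl⟩
    · exact absurd ha (lt_irrefl _)
    rcases pred b with rfl | ⟨y, rfl⟩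
    · exact absurd hb (lt_irrefl _)
    -- A product of two successors is the successor of `x * y + x + y`.
    refine lt_of_le_of_ne ((le_iff _ _).2 ⟨_, add_zero _⟩) fun h => ne (x * y + x + y) ?_
    rw [h]
    ring
  have hl : ∀ a b c : M, 0 < c → a < b → c * a < c * b := by
    intro a b c hc hab
    obtain ⟨z, rfl⟩ := (le_iff _ _).1 hab.le
    have hz : 0 < z := by
      refine lt_of_le_of_ne ((le_iff _ _).2 ⟨_, add_zero _⟩) fun h => ?_
      rw [← h, zero_add] at hab
      exact lt_irrefl _ hab
    rw [mul_add]
    exact lt_add_of_pos_left _ (hp _ _ hc hz)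
  refine ⟨R, O, ?_, hc, hs⟩
  exact
    { hm with
      zero_le_one := (le_iff _ _).2 ⟨1, add_zero _⟩
      exists_pair_ne := hn.1
      mul_lt_mul_of_pos_left := fun c hc a b h => hl a b c hc h
      mul_lt_mul_of_pos_right := fun c hc a b h => by
        rw [mul_comm a, mul_comm b]
        exact hl a b c hc h }

end Sigma0Model

end Raw

/-! ### Powers of two -/

section Predicates

variable {M : Type} [CommSemiring M] [LinearOrder M]

/-- `z` is a power of two: its divisors other than `1` are even. -/
def Pow2 (z : M) : Prop :=
  1 ≤ z ∧ ∀ d ≤ z, (∃ e ≤ z, d * e = z) → d = 1 ∨ ∃ e ≤ d, d = e + e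

/-- `q` is the least power of two above `x`. -/
def IsLen (q x : M) : Prop := Pow2 q ∧ x + 1 ≤ q ∧ q ≤ x + x + 1

end Predicates

/-- Weakening by one bound variable. It is no instance, so the definability proofs put the lifted
terms into the context by hand wherever a term stands below quantifiers. -/
theorem TermDef.lift {ι : Type*} {S : ι → Type} [∀ i, arith.Structure (S i)] {α : Type}
    {env : ∀ i, α → S i} {n : ℕ} {f : ∀ i, (Fin n → S i) → S i} (hf : TermDef env f) :
    TermDef env (fun i (w : Fin (n + 1) → S i) => f i (fun j => w j.castSucc)) := by
  obtain ⟨t, ht⟩ := hf.exists_term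
  refine ⟨⟨t.relabel (Sum.map id Fin.castSucc), fun i v => ?_⟩⟩
  rw [Term.realize_relabel]
  refine Eq.trans ?_ (ht i _)
  congr 1
  funext x
  cases x <;> simp

section Definability

variable {ι : Type*} {S : ι → Type} [∀ i, CommSemiring (S i)] [∀ i, LinearOrder (S i)]
  [∀ i, arith.Structure (S i)] [∀ i, Sigma0Model (S i)] {α : Type} {env : ∀ i, α → S i} {n : ℕ}
  {f g : ∀ i, (Fin n → S i) → S i}

instance [hf : TermDef env f] : Sigma0Def env (fun i v => Pow2 (f i v)) := by
  have h₁ := hf.lift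
  have h₂ := h₁.lift
  unfold Pow2
  infer_instance

instance [TermDef env f] [TermDef env g] : Sigma0Def env (fun i v => IsLen (f i v) (g i v)) := by
  unfold IsLen
  infer_instance

end Definability

section Model

variable {M : Type} [CommSemiring M] [LinearOrder M] [IsStrictOrderedRing M]
  [CanonicallyOrderedAdd M] [arith.Structure M] [Sigma0Model M]

theorem eq_zero_or_eq_add_one (x : M) : x = 0 ∨ ∃ y, x = y + 1 :=
  (Sigma0Model.exists_add_one' x).imp_right fun ⟨y, h⟩ => ⟨y, h.symm⟩

theorem lt_iff_add_one_le {x y : M} : x < y ↔ x + 1 ≤ y := by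
  refine ⟨fun h => ?_, fun h => lt_of_lt_of_le (lt_add_of_pos_right _ zero_lt_one) h⟩
  obtain ⟨z, rfl⟩ := exists_add_of_le h.le
  rcases eq_zero_or_eq_add_one z with rfl | ⟨w, rfl⟩
  · simp at h
  · rw [← add_assoc, add_right_comm]
    exact le_self_add

theorem one_le_iff_ne_zero {x : M} : 1 ≤ x ↔ x ≠ 0 := by
  rw [← pos_iff_ne_zero, lt_iff_add_one_le, zero_add]

theorem lt_add_one_iff' {x y : M} : x < y + 1 ↔ x ≤ y := by
  rw [lt_iff_add_one_le, add_le_add_iff_right]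

theorem le_of_mul_eq {d e z : M} (hz : z ≠ 0) (h : d * e = z) : d ≤ z := by
  have he : 1 ≤ e := one_le_iff_ne_zero.2 (by rintro rfl; simp_all)
  calc d = d * 1 := (mul_one d).symm
    _ ≤ d * e := by gcongr
    _ = z := h

theorem sigma0_strong_induction {P : M → Prop} [Sigma0Pred (fun x (_ : Fin 0 → M) => P x)]
    [h' : Sigma0Pred (fun x (_ : Fin 0 → M) => ∀ y ≤ x, P y)]
    (h : ∀ x, (∀ y < x, P y) → P x) (x : M) : P x := by
  refine sigma0_induction (P := fun x : M => ∀ y ≤ x, P y) ?_ (fun x hx y hy => ?_) x x le_rfl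
  · intro y hy
    refine h y fun z hz => absurd (hz.trans_le hy) (by simp)
  · exact h y fun z hz => hx z (lt_add_one_iff'.1 (hz.trans_le hy))

theorem even_or_odd' (x : M) : ∃ y, x = y + y ∨ x = y + y + 1 := by
  have : ∃ y ≤ x, x = y + y ∨ x = y + y + 1 := by
    refine sigma0_induction (P := fun x : M => ∃ y ≤ x, x = y + y ∨ x = y + y + 1) ?_ ?_ x
    · exact ⟨0, le_rfl, .inl (by simp)⟩
    · rintro x ⟨y, hy, rfl | rfl⟩
      · exact ⟨y, hy.trans le_self_add, .inr rfl⟩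
      · refine ⟨y + 1, by gcongr, .inl (by ring)⟩
  obtain ⟨y, -, h⟩ := this
  exact ⟨y, h⟩

theorem double_lt_of_lt {x y : M} (h : x < y) : x + x + 1 < y + y := by
  have h := lt_iff_add_one_le.1 h
  rw [lt_iff_add_one_le]
  linear_combination 2 * h

theorem double_ne_double_add_one (x y : M) : x + x ≠ y + y + 1 := by
  intro h
  rcases lt_trichotomy x y with hxy | rfl | hxy
  · have h₁ : x + x < y + y + 1 := (add_lt_add hxy hxy).trans_le le_self_add
    exact absurd h h₁.ne
  · exact absurd h (lt_add_of_pos_right _ zero_lt_one).ne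
  · exact absurd h (double_lt_of_lt hxy).ne'

theorem double_inj {x y : M} (h : x + x = y + y) : x = y := by
  rcases lt_trichotomy x y with hxy | rfl | hxy
  · exact absurd h (add_lt_add hxy hxy).ne
  · rfl
  · exact absurd h (add_lt_add hxy hxy).ne'

/-- Divisors of a nonzero number, their cofactors, and halves are bounded automatically, so the
bounds in `Pow2` can be dropped. -/
theorem pow2_iff {z : M} :
    Pow2 z ↔ z ≠ 0 ∧ ∀ d e, d * e = z → d = 1 ∨ ∃ e, d = e + e := by
  constructor
  · rintro ⟨h₁, h₂⟩
    have hz := one_le_iff_ne_zero.1 h₁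
    refine ⟨hz, fun d e h => ?_⟩
    rcases h₂ d (le_of_mul_eq hz h) ⟨e, le_of_mul_eq hz (by rwa [mul_comm]), h⟩ with h | ⟨e, -, h⟩
    · exact .inl h
    · exact .inr ⟨e, h⟩
  · rintro ⟨h₁, h₂⟩
    refine ⟨one_le_iff_ne_zero.2 h₁, fun d hd ⟨e, he, h⟩ => ?_⟩
    rcases h₂ d e h with h | ⟨e, h⟩
    · exact .inl h
    · exact .inr ⟨e, h ▸ le_self_add, h⟩

namespace Pow2

theorem ne_zero {z : M} (h : Pow2 z) : z ≠ 0 := one_le_iff_ne_zero.1 h.1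

theorem pos {z : M} (h : Pow2 z) : 0 < z := pos_iff_ne_zero.2 h.ne_zero

theorem one : Pow2 (1 : M) := by
  refine pow2_iff.2 ⟨one_ne_zero, fun d e h => .inl ?_⟩
  exact le_antisymm (le_of_mul_eq one_ne_zero h)
    (one_le_iff_ne_zero.2 (by rintro rfl; simp at h))

theorem eq_one_or {z : M} (h : Pow2 z) : z = 1 ∨ ∃ y, z = y + y :=
  (pow2_iff.1 h).2 z 1 (mul_one z)

/-- A divisor of `z` also divides `z + z`. Conversely an odd divisor of `z + z` has an even
cofactor, odd times odd being odd, and hence divides `z`. -/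
theorem double_iff {z : M} : Pow2 (z + z) ↔ Pow2 z := by
  constructor
  · intro h
    obtain ⟨h₁, h₂⟩ := pow2_iff.1 h
    refine pow2_iff.2 ⟨fun h0 => h₁ (by simp [h0]), fun d e hd => h₂ d (e + e) ?_⟩
    rw [mul_add, hd]
  · intro h
    obtain ⟨h₁, h₂⟩ := pow2_iff.1 h
    refine pow2_iff.2 ⟨fun h0 => h₁ (add_eq_zero.1 h0).1, fun d e hd => ?_⟩
    obtain ⟨d', rfl | rfl⟩ := even_or_odd' d
    · exact .inr ⟨d', rfl⟩
    · obtain ⟨e', rfl | rfl⟩ := even_or_odd' e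
      · refine h₂ _ e' (double_inj ?_)
        rw [← hd]
        ring
      · refine absurd hd.symm ?_
        have : (d' + d' + 1) * (e' + e' + 1) =
          (d' * (e' + e') + d' + e') + (d' * (e' + e') + d' + e') + 1 := by ring
        rw [this]
        exact double_ne_double_add_one _ _

theorem double {z : M} (h : Pow2 z) : Pow2 (z + z) := double_iff.2 h

/-- Induction along the powers of two. -/
theorem induction {P : M → Prop} [Sigma0Pred (fun x (_ : Fin 0 → M) => P x)]
    [Sigma0Pred (fun x (_ : Fin 0 → M) => Pow2 x → P x)]
    [Sigma0Pred (fun x (_ : Fin 0 → M) => ∀ y ≤ x, Pow2 y → P y)] (h1 : P 1)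
    (h2 : ∀ x, Pow2 x → P x → P (x + x)) {x : M} (hx : Pow2 x) : P x := by
  revert hx
  refine sigma0_strong_induction (P := fun x : M => Pow2 x → P x) (fun x ih hx => ?_) x
  rcases hx.eq_one_or with rfl | ⟨y, rfl⟩
  · exact h1
  · have hy := double_iff.1 hx
    exact h2 y hy (ih y (lt_add_of_pos_right _ hy.pos) hy)

theorem mul {p q : M} (hp : Pow2 p) (hq : Pow2 q) : Pow2 (p * q) := by
  refine Pow2.induction (P := fun p : M => Pow2 (p * q)) ?_ ?_ hp
  · rwa [one_mul]
  · intro p _ h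
    rw [add_mul]
    exact h.double

theorem exists_mul_eq {p q : M} (hp : Pow2 p) (hq : Pow2 q) (h : p ≤ q) :
    ∃ k, Pow2 k ∧ q = p * k := by
  -- The induction step halves `r` together with `p`, so `r` must vary; the bound `q` keeps the
  -- predicate bounded.
  have : ∀ r ≤ q, Pow2 r → p ≤ r → ∃ k ≤ r, Pow2 k ∧ r = p * k := by
    refine Pow2.induction
      (P := fun p : M => ∀ r ≤ q, Pow2 r → p ≤ r → ∃ k ≤ r, Pow2 k ∧ r = p * k) ?_ ?_ hp
    · exact fun r _ hr _ => ⟨r, le_rfl, hr, (one_mul r).symm⟩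
    · intro p hp ih r hrq hr hpr
      rcases hr.eq_one_or with rfl | ⟨s, rfl⟩
      · have h1 : p ≤ p + p := le_self_add
        have := add_le_add hp.1 hp.1
        have h2 := this.trans hpr
        exact absurd h2 (not_le.2 (lt_add_of_pos_right _ zero_lt_one))
      · have hs := double_iff.1 hr
        have hps : p ≤ s := by
          by_contra h
          exact absurd hpr (not_le.2 (add_lt_add (not_le.1 h) (not_le.1 h)))
        obtain ⟨k, hk, hk', rfl⟩ := ih s (le_self_add.trans hrq) hs hps
        exact ⟨k, hk.trans le_self_add, hk', by ring⟩
  obtain ⟨k, -, hk⟩ := this q le_rfl hq h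
  exact ⟨k, hk⟩

/-- The cofactor of `p` in `q` is a power of two other than `1`, hence even. -/
theorem double_le {p q : M} (hp : Pow2 p) (hq : Pow2 q) (h : p < q) : p + p ≤ q := by
  obtain ⟨k, hk, rfl⟩ := hp.exists_mul_eq hq h.le
  rcases hk.eq_one_or with rfl | ⟨j, rfl⟩
  · simp at h
  · have hj := (double_iff.1 hk).1
    have := mul_le_mul_right hj p
    linear_combination 2 * this

end Pow2

/-! ### The length of a binary string, measured by a power of two -/

/-- If `p < q` are powers of two with `x + 1 ≤ p`, then `q ≥ 2 * p ≥ 2 * x + 2`, which is too large.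
-/
theorem IsLen.unique {p q x : M} (hp : IsLen p x) (hq : IsLen q x) : p = q := by
  have key : ∀ {p q : M}, IsLen p x → IsLen q x → ¬ p < q := by
    intro p q hp hq h
    have h₁ := hp.1.double_le hq.1 h
    have h₂ := hp.2.1
    have h₃ := hq.2.2
    have : x + x + 1 + 1 ≤ x + x + 1 := by linear_combination 2 * h₂ + h₁ + h₃
    exact absurd this (not_le.2 (lt_add_of_pos_right _ zero_lt_one))
  exact le_antisymm (not_lt.1 (key hq hp)) (not_lt.1 (key hp hq))

theorem exists_isLen (x : M) : ∃ q, IsLen q x := by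
  have : ∃ q ≤ x + x + 1, IsLen q x := by
    refine sigma0_induction (P := fun x : M => ∃ q ≤ x + x + 1, IsLen q x) ?_ ?_ x
    · exact ⟨1, by simp, Pow2.one, by simp, by simp⟩
    · rintro x ⟨q, hq, h₁, h₂, h₃⟩
      rcases le_or_gt (x + 1 + 1) q with h | h
      · have : q ≤ x + 1 + (x + 1) + 1 := by
          have : x + x + 1 ≤ x + x + 1 + 2 := le_self_add
          linear_combination this + h₃
        exact ⟨q, this, h₁, h, this⟩
      -- The old power of two is exactly `x + 1`, so it is doubled.
      · obtain rfl := le_antisymm h₂ (lt_add_one_iff'.1 h)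
        refine ⟨x + 1 + (x + 1), le_self_add, h₁.double, ?_, le_self_add⟩
        have := le_self_add (a := x + 1 + 1) (b := x)
        linear_combination this
  obtain ⟨q, -, h⟩ := this
  exact ⟨q, h⟩

/-- The least power of two above `x`. -/
noncomputable def len (x : M) : M := (exists_isLen x).choose

theorem isLen_len (x : M) : IsLen (len x) x := (exists_isLen x).choose_spec

theorem isLen_iff {q x : M} : IsLen q x ↔ q = len x :=
  ⟨fun h => h.unique (isLen_len x), fun h => h ▸ isLen_len x⟩

theorem pow2_len (x : M) : Pow2 (len x) := (isLen_len x).1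

theorem lt_len (x : M) : x < len x := lt_iff_add_one_le.2 (isLen_len x).2.1

theorem len_le (x : M) : len x ≤ x + x + 1 := (isLen_len x).2.2

theorem len_zero : len (0 : M) = 1 :=
  (isLen_iff.1 ⟨Pow2.one, by simp, by simp⟩).symm

/-- A power of two is `1` or even, so the value `2 * x + 1` is excluded. -/
theorem len_le_of_ne_zero {x : M} (hx : x ≠ 0) : len x ≤ x + x := by
  rcases (pow2_len x).eq_one_or with h | ⟨y, h⟩
  · rw [h]
    exact (one_le_iff_ne_zero.2 hx).trans le_self_add
  · have := len_le x
    rcases this.lt_or_eq with h' | h'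
    · exact lt_add_one_iff'.1 h'
    · exact absurd (h.symm.trans h') (double_ne_double_add_one _ _)

/-- Concatenation of binary strings without leading zeros. -/
noncomputable def cat (x y : M) : M := x * len y + y

/-! ### Division with remainder and concatenation of strings -/

theorem mul_add_lt {x y p q : M} (hx : x < p) (hy : y < q) : x * q + y < p * q := by
  calc x * q + y < x * q + q := by gcongr
    _ = (x + 1) * q := by ring
    _ ≤ p * q := by
      have := lt_iff_add_one_le.1 hx
      gcongr

theorem mul_add_inj {x y x' y' q : M} (hy : y < q) (hy' : y' < q)
    (h : x * q + y = x' * q + y') : x = x' ∧ y = y' := by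
  have key : ∀ {x y x' y' : M}, y < q → x * q + y = x' * q + y' → ¬ x < x' := by
    intro x y x' y' hy h hx
    have := mul_add_lt hx hy
    rw [h] at this
    exact absurd this (not_lt.2 le_self_add)
  have hx : x = x' := le_antisymm (not_lt.1 (key hy' h.symm)) (not_lt.1 (key hy h))
  subst hx
  exact ⟨rfl, add_left_cancel h⟩

theorem exists_div_mod (x : M) {q : M} (hq : q ≠ 0) : ∃ y z, x = y * q + z ∧ z < q := by
  have : ∃ y ≤ x, ∃ z ≤ x, x = y * q + z ∧ z + 1 ≤ q := by
    refine sigma0_induction (P := fun x : M => ∃ y ≤ x, ∃ z ≤ x, x = y * q + z ∧ z + 1 ≤ q) ?_ ?_ x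
    · exact ⟨0, le_rfl, 0, le_rfl, by simp, by simpa using one_le_iff_ne_zero.2 hq⟩
    · rintro x ⟨y, hy, z, hz, h₁, h₂⟩
      rcases h₂.lt_or_eq with h | h
      · exact ⟨y, hy.trans le_self_add, z + 1, by gcongr, by rw [h₁]; ring,
          lt_iff_add_one_le.1 h⟩
      · refine ⟨y + 1, by gcongr, 0, zero_le, ?_, by simpa using one_le_iff_ne_zero.2 hq⟩
        rw [h₁, add_assoc, h]
        ring
  obtain ⟨y, -, z, -, h, h'⟩ := this
  exact ⟨y, z, h, lt_iff_add_one_le.2 h'⟩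

/-- The upper bound needs `len x ≤ 2 * x`, which fails for `x = 0`; that case is separate. -/
theorem len_cat (x y : M) : len (cat x y) = len x * len y := by
  refine (isLen_iff.1 ⟨(pow2_len x).mul (pow2_len y), ?_, ?_⟩).symm
  · exact lt_iff_add_one_le.1 (mul_add_lt (lt_len x) (lt_len y))
  · rcases eq_or_ne x 0 with rfl | hx
    · simpa [cat, len_zero] using len_le y
    · have h := mul_le_mul_left (len_le_of_ne_zero hx) (len y)
      refine h.trans ?_
      unfold cat
      have := le_self_add (a := x * len y + x * len y) (b := y + y + 1)
      linear_combination this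

theorem cat_assoc (x y z : M) : cat (cat x y) z = cat x (cat y z) := by
  conv_rhs => rw [cat, len_cat]
  unfold cat
  ring

@[simp] theorem zero_cat (x : M) : cat 0 x = x := by simp [cat]

@[simp] theorem cat_zero (x : M) : cat x 0 = x := by simp [cat, len_zero]

theorem cat_eq_zero {x y : M} : cat x y = 0 ↔ x = 0 ∧ y = 0 := by
  simp only [cat, add_eq_zero, mul_eq_zero, (pow2_len y).ne_zero, or_false]

/-- Equidivisibility: if `x ^ y = u ^ w` and `y` is not longer than `w`, then `y` is an end of
`w`. -/
theorem exists_cat_eq {x y u w : M} (h : cat x y = cat u w) (hl : len y ≤ len w) :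
    ∃ z, x = cat u z ∧ w = cat z y ∧ len w = len z * len y := by
  obtain ⟨k, hk, hk'⟩ := (pow2_len y).exists_mul_eq (pow2_len w) hl
  -- The middle piece is the quotient of `w` by `len y`. Comparing both factorizations modulo `len
  -- y` identifies the remainder with `y`.
  obtain ⟨z, t, hw, ht⟩ := exists_div_mod w (pow2_len y).ne_zero
  have e : x * len y + y = (u * k + z) * len y + t := by
    have : x * len y + y = u * len w + w := h
    rw [this, hk', hw]
    ring
  obtain ⟨h₁, rfl⟩ := mul_add_inj (lt_len y) ht e
  -- The cofactor `k` is the length of `z`: otherwise `w = z * len y + y` would violate `w < len w`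
  -- or `len w ≤ 2 * w + 1`.
  have hz : IsLen k z := by
    refine ⟨hk, lt_iff_add_one_le.1 ?_, lt_add_one_iff'.1 ?_⟩
    · by_contra hkz
      have h₂ := mul_le_mul_left (not_lt.1 hkz) (len y)
      have h₃ := lt_len w
      rw [hk', hw] at h₃
      have h₄ : z * len y ≤ z * len y + y := le_self_add
      exact absurd (h₃.trans_le ((mul_comm _ _).le.trans h₂)) (not_lt.2 h₄)
    · by_contra hkz
      have h₂ := mul_le_mul_left (not_lt.1 hkz) (len y)
      have h₃ := len_le w
      rw [hk', hw] at h₃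
      have h₄ := lt_iff_add_one_le.1 (lt_len y)
      have : z * len y + z * len y + y + y + 1 + 1 ≤ z * len y + z * len y + y + y + 1 := by
        linear_combination h₂ + h₃ + 2 * h₄
      exact absurd this (not_le.2 (lt_add_of_pos_right _ zero_lt_one))
  obtain rfl := isLen_iff.1 hz
  exact ⟨z, h₁, hw, by rw [hk', mul_comm]⟩

theorem cat_left_cancel {x y z : M} (h : cat x y = cat x z) : y = z := by
  have key : ∀ {y z : M}, cat x y = cat x z → len y ≤ len z → y = z := by
    intro y z h hl
    obtain ⟨t, h₁, h₂, -⟩ := exists_cat_eq h hl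
    -- The middle piece satisfies `x = cat x t`, so it has length `1` and is empty.
    have h₃ : len x * 1 = len x * len t := by rw [← len_cat, ← h₁, mul_one]
    have h₄ := mul_left_cancel₀ (pow2_len x).ne_zero h₃
    have h₅ := lt_len t
    rw [← h₄, lt_iff_add_one_le] at h₅
    have : t = 0 := by
      by_contra ht
      have := one_le_iff_ne_zero.2 ht
      have h₆ : (1 : M) + 1 ≤ 1 := (add_le_add this le_rfl).trans h₅
      exact absurd h₆ (not_le.2 (lt_add_of_pos_right _ zero_lt_one))
    rw [h₂, this, zero_cat]
  rcases le_total (len y) (len z) with hl | hl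
  · exact key h hl
  · exact (key h.symm hl).symm

theorem cat_right_cancel {x y z : M} (h : cat x z = cat y z) : x = y :=
  (mul_add_inj (lt_len z) (lt_len z) h).1

end Model

/-! ### Codes of sequences -/

section Predicates

variable {M : Type} [CommSemiring M] [LinearOrder M]

/-- `x` is the code of a sequence: its binary representation has even length. -/
def IsSeq (x : M) : Prop := ∃ h ≤ x + 1, Pow2 h ∧ IsLen (h * h) x

/-- The graph of concatenation. -/
def CatRel (s t u : M) : Prop :=
  (IsSeq s ∧ IsSeq t ∧ ∃ q ≤ t + t + 1, IsLen q t ∧ u = s * q + t) ∨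
    (¬ (IsSeq s ∧ IsSeq t) ∧ u = 0)

/-- `w` is the code of a sequence of length one, that is, an irreducible code. -/
def IsBlock (w : M) : Prop :=
  IsSeq w ∧ ¬ w = 0 ∧ ∀ u ≤ w, ∀ v ≤ w, IsSeq u → IsSeq v → CatRel u v w → u = 0 ∨ v = 0

/-- The binary digit of `x` at the power of two `q` is `1`. -/
def Bit (q x : M) : Prop := ∃ y ≤ x, ∃ z ≤ x, z + 1 ≤ q ∧ x = (y + y + 1) * q + z

/-- `w` is the code of `⟨n⟩`, for irreducible codes `w`: the binary digits of `n + 2` after the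
first one are the digits of `w` at even positions. -/
def Codes (n w : M) : Prop :=
  ∃ h ≤ n + 1 + 1, Pow2 h ∧ n + 1 + 1 + 1 ≤ h + h ∧ IsLen (h * h) w ∧
    ∀ q ≤ h, Pow2 q → q + 1 ≤ h → (Bit q (n + 1 + 1) ↔ Bit (q * q) w)

/-- `n` is a term of the sequence with code `x`. -/
def Mem (n x : M) : Prop :=
  ∃ u ≤ x, ∃ w ≤ x, ∃ v ≤ x, ∃ p ≤ x,
    IsSeq u ∧ IsSeq v ∧ IsBlock w ∧ Codes n w ∧ CatRel u w p ∧ CatRel p v x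

end Predicates

section Definability

variable {ι : Type*} {S : ι → Type} [∀ i, CommSemiring (S i)] [∀ i, LinearOrder (S i)]
  [∀ i, arith.Structure (S i)] [∀ i, Sigma0Model (S i)] {α : Type} {env : ∀ i, α → S i} {n : ℕ}
  {f g k : ∀ i, (Fin n → S i) → S i}

instance [hf : TermDef env f] : Sigma0Def env (fun i v => IsSeq (f i v)) := by
  have h₁ := hf.lift
  unfold IsSeq
  infer_instance

instance [hf : TermDef env f] [hg : TermDef env g] [hk : TermDef env k] :
    Sigma0Def env (fun i v => CatRel (f i v) (g i v) (k i v)) := by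
  have h₁ := hf.lift
  have h₂ := hg.lift
  have h₃ := hk.lift
  unfold CatRel
  infer_instance

instance [hf : TermDef env f] : Sigma0Def env (fun i v => IsBlock (f i v)) := by
  have h₁ := hf.lift
  have h₂ := h₁.lift
  unfold IsBlock
  infer_instance

instance [hf : TermDef env f] [hg : TermDef env g] :
    Sigma0Def env (fun i v => Bit (f i v) (g i v)) := by
  have h₁ := hf.lift
  have h₂ := h₁.lift
  have h₃ := hg.lift
  have h₄ := h₃.lift
  unfold Bit
  infer_instance

instance [hf : TermDef env f] [hg : TermDef env g] :
    Sigma0Def env (fun i v => Codes (f i v) (g i v)) := by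
  have h₁ := hf.lift
  have h₂ := h₁.lift
  have h₃ := hg.lift
  have h₄ := h₃.lift
  unfold Codes
  infer_instance

instance [hf : TermDef env f] [hg : TermDef env g] :
    Sigma0Def env (fun i v => Mem (f i v) (g i v)) := by
  have h₁ := hf.lift.lift.lift.lift
  have h₃ := hg.lift
  have h₄ := h₃.lift
  have h₅ := h₄.lift
  have h₆ := h₅.lift
  unfold Mem
  infer_instance

end Definability

section Model

variable {M : Type} [CommSemiring M] [LinearOrder M] [IsStrictOrderedRing M]
  [CanonicallyOrderedAdd M] [arith.Structure M] [Sigma0Model M]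

theorem Pow2.eq_one_or_double {h : M} (hh : Pow2 h) : h = 1 ∨ ∃ g, Pow2 g ∧ h = 2 * g := by
  rcases hh.eq_one_or with h1 | ⟨g, rfl⟩
  · exact .inl h1
  · exact .inr ⟨g, double_iff.1 hh, (two_mul g).symm⟩

theorem mul_self_inj' {x y : M} (h : x * x = y * y) : x = y := by
  rcases lt_trichotomy x y with hxy | rfl | hxy
  · exact absurd h (mul_lt_mul'' hxy hxy zero_le zero_le).ne
  · rfl
  · exact absurd h (mul_lt_mul'' hxy hxy zero_le zero_le).ne'

/-- The bound on `h` is automatic: if `h = 2 * g`, then `2 * h = 4 * g ≤ 4 * g * g = len x ≤ 2 * x +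
1`. -/
theorem isSeq_iff {x : M} : IsSeq x ↔ ∃ h, Pow2 h ∧ len x = h * h := by
  constructor
  · rintro ⟨h, -, h₁, h₂⟩
    exact ⟨h, h₁, (isLen_iff.1 h₂).symm⟩
  · rintro ⟨h, h₁, h₂⟩
    refine ⟨h, ?_, h₁, isLen_iff.2 h₂.symm⟩
    rcases h₁.eq_one_or_double with rfl | ⟨g, hg, rfl⟩
    · exact le_add_self
    · have h₃ := len_le x
      rw [h₂] at h₃
      have h₄ := mul_le_mul_right hg.1 (4 * g)
      by_contra h₅
      have h₆ := lt_iff_add_one_le.1 (not_le.1 h₅)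
      have : x + x + 1 + 3 ≤ x + x + 1 := by
        linear_combination h₃ + h₄ + 2 * h₆
      exact absurd this (not_le.2 (lt_add_of_pos_right _ (by norm_num)))

theorem isSeq_zero : IsSeq (0 : M) := isSeq_iff.2 ⟨1, Pow2.one, by rw [len_zero, mul_one]⟩

theorem IsSeq.cat {x y : M} (hx : IsSeq x) (hy : IsSeq y) : IsSeq (cat x y) := by
  obtain ⟨g, hg, hg'⟩ := isSeq_iff.1 hx
  obtain ⟨h, hh, hh'⟩ := isSeq_iff.1 hy
  refine isSeq_iff.2 ⟨g * h, hg.mul hh, ?_⟩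
  rw [len_cat, hg', hh']
  ring

/-- Powers of two are linearly ordered by divisibility, so a quotient of two of their squares is the
square of a power of two. -/
theorem IsSeq.of_len_mul {y z w : M} (hy : IsSeq y) (hw : IsSeq w)
    (h : len w = len z * len y) : IsSeq z := by
  obtain ⟨g, hg, hg'⟩ := isSeq_iff.1 hw
  obtain ⟨k, hk, hk'⟩ := isSeq_iff.1 hy
  rw [hg', hk'] at h
  have hkg : k ≤ g := by
    by_contra hlt
    have h₁ := not_le.1 hlt
    have h₂ := mul_lt_mul'' h₁ h₁ zero_le zero_le
    have h₃ := mul_le_mul_left (pow2_len z).1 (k * k)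
    rw [one_mul, ← h] at h₃
    exact absurd h₃ (not_le.2 h₂)
  obtain ⟨j, hj, rfl⟩ := hk.exists_mul_eq hg hkg
  refine isSeq_iff.2 ⟨j, hj, mul_right_cancel₀ (mul_ne_zero hk.ne_zero hk.ne_zero) ?_⟩
  rw [← h]
  ring

theorem catRel_iff {s t u : M} (hs : IsSeq s) (ht : IsSeq t) : CatRel s t u ↔ u = cat s t := by
  constructor
  · rintro (⟨-, -, q, -, hq, h⟩ | ⟨h, -⟩)
    · rw [h, isLen_iff.1 hq]
      rfl
    · exact absurd ⟨hs, ht⟩ h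
  · rintro rfl
    exact .inl ⟨hs, ht, len t, len_le t, isLen_len t, rfl⟩

theorem catRel_of_not {s t u : M} (h : ¬ (IsSeq s ∧ IsSeq t)) : CatRel s t u ↔ u = 0 := by
  constructor
  · rintro (⟨hs, ht, -⟩ | ⟨-, h'⟩)
    · exact absurd ⟨hs, ht⟩ h
    · exact h'
  · exact fun h' => .inr ⟨h, h'⟩

/-- Levi's lemma inside the codes: the middle piece has even length because both ends have. -/
theorem levi {x y u w : M} (hy : IsSeq y) (hw : IsSeq w) (h : cat x y = cat u w) :
    (∃ z, IsSeq z ∧ x = cat u z ∧ w = cat z y) ∨ ∃ z, IsSeq z ∧ u = cat x z ∧ y = cat z w := by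
  rcases le_total (len y) (len w) with hl | hl
  · obtain ⟨z, h₁, h₂, h₃⟩ := exists_cat_eq h hl
    exact .inl ⟨z, hy.of_len_mul hw h₃, h₁, h₂⟩
  · obtain ⟨z, h₁, h₂, h₃⟩ := exists_cat_eq h.symm hl
    exact .inr ⟨z, hw.of_len_mul hy h₃, h₁, h₂⟩

theorem le_cat_left (x y : M) : x ≤ cat x y := by
  calc x = x * 1 := (mul_one x).symm
    _ ≤ x * len y := mul_le_mul_right (pow2_len y).1 x
    _ ≤ cat x y := le_self_add

theorem le_cat_right (x y : M) : y ≤ cat x y := le_add_self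

theorem lt_cat_left (x : M) {y : M} (hy : y ≠ 0) : x < cat x y := by
  refine (le_cat_left x y).lt_of_ne fun h => hy (cat_left_cancel (x := x) ?_)
  rw [← h, cat_zero]

theorem lt_cat_right {x : M} (hx : x ≠ 0) (y : M) : y < cat x y := by
  refine (le_cat_right x y).lt_of_ne fun h => hx (cat_right_cancel (z := y) ?_)
  rw [← h, zero_cat]

/-- The factors of a string are at most the string, so the bounds can be dropped; the same applies
in `mem_iff`. -/
theorem isBlock_iff {w : M} :
    IsBlock w ↔ IsSeq w ∧ w ≠ 0 ∧
      ∀ u v, IsSeq u → IsSeq v → w = cat u v → u = 0 ∨ v = 0 := by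
  constructor
  · rintro ⟨h₁, h₂, h₃⟩
    refine ⟨h₁, h₂, fun u v hu hv h => ?_⟩
    refine h₃ u (h ▸ le_cat_left u v) v (h ▸ le_cat_right u v) hu hv ((catRel_iff hu hv).2 h)
  · rintro ⟨h₁, h₂, h₃⟩
    exact ⟨h₁, h₂, fun u _ v _ hu hv h => h₃ u v hu hv ((catRel_iff hu hv).1 h)⟩

theorem mem_iff {n x : M} :
    Mem n x ↔ ∃ u w v, IsSeq u ∧ IsSeq v ∧ IsBlock w ∧ Codes n w ∧ x = cat (cat u w) v := by
  constructor
  · rintro ⟨u, -, w, -, v, -, p, -, hu, hv, hw, hn, h₁, h₂⟩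
    obtain rfl := (catRel_iff hu hw.1).1 h₁
    exact ⟨u, w, v, hu, hv, hw, hn, (catRel_iff (hu.cat hw.1) hv).1 h₂⟩
  · rintro ⟨u, w, v, hu, hv, hw, hn, rfl⟩
    have h₁ := le_cat_left (cat u w) v
    exact ⟨u, (le_cat_left u w).trans h₁, w, (le_cat_right u w).trans h₁, v, le_cat_right _ _,
      cat u w, h₁, hu, hv, hw, hn, (catRel_iff hu hw.1).2 rfl,
      (catRel_iff (hu.cat hw.1) hv).2 rfl⟩

theorem not_mem_zero (n : M) : ¬ Mem n 0 := by
  rw [mem_iff]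
  rintro ⟨u, w, v, -, -, hw, -, h⟩
  exact hw.2.1 (cat_eq_zero.1 (cat_eq_zero.1 h.symm).1).2

/-- Irreducibility forces the pieces before and after a block factor to be empty. -/
theorem mem_block {n w : M} (hw : IsBlock w) : Mem n w ↔ Codes n w := by
  rw [mem_iff]
  constructor
  · rintro ⟨u, w', v, hu, hv, hw', hn, h⟩
    rcases (isBlock_iff.1 hw).2.2 _ _ (hu.cat hw'.1) hv h with h₁ | rfl
    · exact absurd (cat_eq_zero.1 h₁).2 hw'.2.1
    · rw [cat_zero] at h
      rcases (isBlock_iff.1 hw).2.2 _ _ hu hw'.1 h with rfl | h₁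
      · rwa [h, zero_cat]
      · exact absurd h₁ hw'.2.1
  · intro h
    exact ⟨0, w, 0, isSeq_zero, isSeq_zero, hw, h, by simp⟩

theorem mem_cat {n s t : M} (hs : IsSeq s) (ht : IsSeq t) :
    Mem n (cat s t) ↔ Mem n s ∨ Mem n t := by
  simp only [mem_iff]
  constructor
  · rintro ⟨u, w, v, hu, hv, hw, hn, h⟩
    -- Compare the end of the block `w` with the cut between `s` and `t`, and then its beginning.
    rcases levi ht hv h with ⟨z, hz, rfl, rfl⟩ | ⟨z, hz, h₁, rfl⟩
    · exact .inl ⟨u, w, z, hu, hz, hw, hn, rfl⟩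
    rcases levi hw.1 hz h₁ with ⟨y, hy, rfl, rfl⟩ | ⟨y, hy, rfl, h₂⟩
    · exact .inr ⟨y, w, v, hy, hv, hw, hn, rfl⟩
    -- The cut falls within `w = cat y z`, so one of the two parts is empty.
    rcases (isBlock_iff.1 hw).2.2 _ _ hy hz h₂ with rfl | rfl
    · rw [zero_cat] at h₂
      subst h₂
      exact .inr ⟨0, w, v, isSeq_zero, hv, hw, hn, by simp⟩
    · rw [cat_zero] at h₂
      subst h₂
      exact .inl ⟨u, w, 0, hu, isSeq_zero, hw, hn, by simp⟩
  · rintro (⟨u, w, v, hu, hv, hw, hn, rfl⟩ | ⟨u, w, v, hu, hv, hw, hn, rfl⟩)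
    · exact ⟨u, w, cat v t, hu, hv.cat ht, hw, hn, cat_assoc _ _ _⟩
    · exact ⟨cat s u, w, v, hs.cat hu, hv, hw, hn, by simp only [cat_assoc]⟩

/-- A nonempty code that is not a block splits into two nonempty codes; the left one is smaller and
supplies the first block. -/
theorem exists_first_block {s : M} (hs : IsSeq s) (h0 : s ≠ 0) :
    ∃ w t, IsBlock w ∧ IsSeq t ∧ s = cat w t := by
  -- Bounded quantifiers and `CatRel` are used to make this predicate a bounded formula.
  have key : IsSeq s → ¬ s = 0 → ∃ w ≤ s, ∃ t ≤ s, IsBlock w ∧ IsSeq t ∧ CatRel w t s := by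
    refine sigma0_strong_induction
      (P := fun s : M => IsSeq s → ¬ s = 0 → ∃ w ≤ s, ∃ t ≤ s, IsBlock w ∧ IsSeq t ∧ CatRel w t s)
      (fun s ih hs h0 => ?_) s
    by_cases hb : IsBlock s
    · exact ⟨s, le_rfl, 0, zero_le, hb, isSeq_zero, (catRel_iff hs isSeq_zero).2 (by simp)⟩
    · rw [isBlock_iff] at hb
      push Not at hb
      obtain ⟨u, v, hu, hv, rfl, hu0, hv0⟩ := hb hs h0
      obtain ⟨w, hw, t, ht, hwb, hts, hc⟩ := ih u (lt_cat_left u hv0) hu hu0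
      obtain rfl := (catRel_iff hwb.1 hts).1 hc
      refine ⟨w, hw.trans (le_cat_left _ _), cat t v, ?_, hwb, hts.cat hv,
        (catRel_iff hwb.1 (hts.cat hv)).2 (cat_assoc _ _ _)⟩
      rw [cat_assoc]
      exact le_cat_right _ _
  obtain ⟨w, -, t, -, hw, ht, h⟩ := key hs h0
  exact ⟨w, t, hw, ht, (catRel_iff hw.1 ht).1 h⟩

theorem exists_last_block {s : M} (hs : IsSeq s) (h0 : s ≠ 0) :
    ∃ w t, IsBlock w ∧ IsSeq t ∧ s = cat t w := by
  have key : IsSeq s → ¬ s = 0 → ∃ w ≤ s, ∃ t ≤ s, IsBlock w ∧ IsSeq t ∧ CatRel t w s := by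
    refine sigma0_strong_induction
      (P := fun s : M => IsSeq s → ¬ s = 0 → ∃ w ≤ s, ∃ t ≤ s, IsBlock w ∧ IsSeq t ∧ CatRel t w s)
      (fun s ih hs h0 => ?_) s
    by_cases hb : IsBlock s
    · exact ⟨s, le_rfl, 0, zero_le, hb, isSeq_zero, (catRel_iff isSeq_zero hs).2 (by simp)⟩
    · rw [isBlock_iff] at hb
      push Not at hb
      obtain ⟨u, v, hu, hv, rfl, hu0, hv0⟩ := hb hs h0
      obtain ⟨w, hw, t, ht, hwb, hts, hc⟩ := ih v (lt_cat_right hu0 v) hv hv0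
      obtain rfl := (catRel_iff hts hwb.1).1 hc
      refine ⟨w, hw.trans (le_cat_right _ _), cat u t, ?_, hwb, hu.cat hts,
        (catRel_iff (hu.cat hts) hwb.1).2 (cat_assoc _ _ _).symm⟩
      rw [← cat_assoc]
      exact le_cat_left _ _
  obtain ⟨w, -, t, -, hw, ht, h⟩ := key hs h0
  exact ⟨w, t, hw, ht, (catRel_iff ht hw.1).1 h⟩

end Model

/-! ### Codes of sequences of length one -/

section Model

variable {M : Type} [CommSemiring M] [LinearOrder M] [IsStrictOrderedRing M]
  [CanonicallyOrderedAdd M] [arith.Structure M] [Sigma0Model M]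

/-! ### The last binary digits of a number -/

theorem le_one_iff {e : M} : e ≤ 1 ↔ e = 0 ∨ e = 1 := by
  constructor
  · intro h
    rcases eq_zero_or_eq_add_one e with rfl | ⟨d, rfl⟩
    · exact .inl rfl
    · right
      have : d = 0 := by simpa using h
      rw [this, zero_add]
  · rintro (rfl | rfl)
    · exact zero_le_one
    · exact le_rfl

theorem lt_two_iff {e : M} : e < 2 ↔ e ≤ 1 := by
  rw [← one_add_one_eq_two, lt_add_one_iff']

theorem exists_two_mul_add (x : M) : ∃ y e, e ≤ 1 ∧ x = 2 * y + e := by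
  obtain ⟨y, z, h, hz⟩ := exists_div_mod x (two_ne_zero (α := M))
  exact ⟨y, z, lt_two_iff.1 hz, by rw [h, mul_comm]⟩

theorem two_mul_add_inj {x y d e : M} (hd : d ≤ 1) (he : e ≤ 1) (h : 2 * x + d = 2 * y + e) :
    x = y ∧ d = e := by
  rw [mul_comm 2, mul_comm 2] at h
  exact mul_add_inj (lt_two_iff.2 hd) (lt_two_iff.2 he) h

theorem bit_iff {q x : M} (hq : q ≠ 0) : Bit q x ↔ ∃ y z, z < q ∧ x = (2 * y + 1) * q + z := by
  constructor
  · rintro ⟨y, -, z, -, hz, h⟩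
    exact ⟨y, z, lt_iff_add_one_le.2 hz, by rw [h, two_mul]⟩
  · rintro ⟨y, z, hz, rfl⟩
    refine ⟨y, ?_, z, le_add_self, lt_iff_add_one_le.1 hz, by rw [two_mul]⟩
    have h₁ : y ≤ 2 * y + 1 := by
      rw [two_mul, add_assoc]
      exact le_self_add
    calc y ≤ (2 * y + 1) * 1 := by rwa [mul_one]
      _ ≤ (2 * y + 1) * q := mul_le_mul_right (one_le_iff_ne_zero.2 hq) _
      _ ≤ _ := le_self_add

theorem bit_one {y e : M} (he : e ≤ 1) : Bit 1 (2 * y + e) ↔ e = 1 := by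
  rw [bit_iff one_ne_zero]
  constructor
  · rintro ⟨a, z, hz, h⟩
    have : z = 0 := by simpa using lt_iff_add_one_le.1 hz
    rw [this, mul_one, add_zero] at h
    exact (two_mul_add_inj he le_rfl h).2
  · rintro rfl
    exact ⟨y, 0, zero_lt_one, by simp⟩

theorem bit_two_mul {q y e : M} (hq : q ≠ 0) (he : e ≤ 1) :
    Bit (2 * q) (2 * y + e) ↔ Bit q y := by
  rw [bit_iff hq, bit_iff (mul_ne_zero two_ne_zero hq)]
  constructor
  · rintro ⟨a, z, hz, h⟩
    obtain ⟨c, d, hd, rfl⟩ := exists_two_mul_add z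
    obtain ⟨rfl, -⟩ := two_mul_add_inj (y := (2 * a + 1) * q + c) he hd (by rw [h]; ring)
    refine ⟨a, c, ?_, rfl⟩
    by_contra hc
    have := mul_le_mul_right (not_lt.1 hc) 2
    exact absurd hz (not_lt.2 (this.trans le_self_add))
  · rintro ⟨a, z, hz, rfl⟩
    refine ⟨a, 2 * z + e, ?_, by ring⟩
    have := lt_iff_add_one_le.1 hz
    rw [lt_iff_add_one_le]
    linear_combination 2 * this + he

theorem bit_four_mul {q y e : M} (hq : q ≠ 0) (he : e ≤ 1) :
    Bit (4 * q) (4 * y + e) ↔ Bit q y := by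
  have h₁ : 4 * q = 2 * (2 * q) := by ring
  have h₂ : 4 * y + e = 2 * (2 * y + 0) + e := by ring
  rw [h₁, h₂, bit_two_mul (mul_ne_zero two_ne_zero hq) he, bit_two_mul hq zero_le_one]

theorem bit_one_four {y e : M} (he : e ≤ 1) : Bit 1 (4 * y + e) ↔ e = 1 := by
  have h₂ : 4 * y + e = 2 * (2 * y) + e := by ring
  rw [h₂, bit_one he]

theorem pow2_two : Pow2 (2 : M) := by
  rw [← one_add_one_eq_two]
  exact Pow2.one.double

theorem two_le_len {x : M} (hx : x ≠ 0) : 2 ≤ len x := by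
  have h₁ := lt_iff_add_one_le.1 (lt_len x)
  rw [← one_add_one_eq_two]
  exact (add_le_add (one_le_iff_ne_zero.2 hx) le_rfl).trans h₁

theorem len_four_mul {w e : M} (hw : w ≠ 0) (he : e ≤ 3) : len (4 * w + e) = 4 * len w := by
  refine (isLen_iff.1 ⟨?_, ?_, ?_⟩).symm
  · have h : 4 * len w = 2 * 2 * len w := by ring
    rw [h]
    exact (pow2_two.mul pow2_two).mul (pow2_len w)
  · have := lt_iff_add_one_le.1 (lt_len w)
    linear_combination 4 * this + he
  · have := len_le_of_ne_zero hw
    have h₂ : 4 * len w + 0 ≤ 4 * len w + (2 * e + 1) := by gcongr; exact zero_le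
    linear_combination 4 * this + h₂

theorem isSeq_len_four {x : M} (hx : IsSeq x) (h0 : x ≠ 0) :
    ∃ j, Pow2 j ∧ len x = 4 * (j * j) := by
  obtain ⟨h, hh, hx⟩ := isSeq_iff.1 hx
  rcases hh.eq_one_or_double with rfl | ⟨j, hj, rfl⟩
  · have := two_le_len h0
    rw [hx, mul_one] at this
    exact absurd this (not_le.2 one_lt_two)
  · exact ⟨j, hj, by rw [hx]; ring⟩

theorem isSeq_four_mul {w e : M} (hw : IsSeq w) (h0 : w ≠ 0) (he : e ≤ 3) :
    IsSeq (4 * w + e) := by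
  obtain ⟨h, hh, hx⟩ := isSeq_iff.1 hw
  refine isSeq_iff.2 ⟨2 * h, pow2_two.mul hh, ?_⟩
  rw [len_four_mul h0 he, hx]
  ring

theorem le_three_iff {d : M} : d ≤ 3 ↔ d = 0 ∨ d = 1 ∨ d = 2 ∨ d = 3 := by
  have h₃ : (3 : M) = 2 + 1 := by norm_num
  have h₂ : (2 : M) = 1 + 1 := by norm_num
  rw [le_iff_lt_or_eq, h₃, lt_add_one_iff', le_iff_lt_or_eq, lt_two_iff, le_one_iff, or_assoc,
    or_assoc]

theorem exists_four_mul_add (x : M) : ∃ y d, d ≤ 3 ∧ x = 4 * y + d := by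
  obtain ⟨y, z, h, hz⟩ := exists_div_mod x (four_ne_zero (α := M))
  refine ⟨y, z, ?_, by rw [h, mul_comm]⟩
  have h₃ : (4 : M) = 3 + 1 := by norm_num
  rwa [h₃, lt_add_one_iff'] at hz

theorem four_mul_add_inj {x y d e : M} (hd : d ≤ 3) (he : e ≤ 3) (h : 4 * x + d = 4 * y + e) :
    x = y ∧ d = e := by
  have h₃ : (4 : M) = 3 + 1 := by norm_num
  rw [mul_comm 4, mul_comm 4] at h
  exact mul_add_inj (by rwa [h₃, lt_add_one_iff']) (by rwa [h₃, lt_add_one_iff']) h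

/-- A nonempty code is `2` or `3`, or it is obtained from a shorter nonempty code by adding two
binary digits. -/
theorem IsSeq.four_mul_cases {x : M} (hx : IsSeq x) (h0 : x ≠ 0) :
    x = 2 ∨ x = 3 ∨ ∃ y d, IsSeq y ∧ y ≠ 0 ∧ d ≤ 3 ∧ x = 4 * y + d := by
  obtain ⟨j, hj, hl⟩ := isSeq_len_four hx h0
  obtain ⟨y, d, hd, rfl⟩ := exists_four_mul_add x
  have hle := len_le_of_ne_zero h0
  rw [hl] at hle
  have hj1 := (hj.mul hj).1
  rcases eq_or_ne y 0 with rfl | hy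
  · rw [mul_zero, zero_add] at *
    rcases le_three_iff.1 hd with rfl | rfl | rfl | rfl
    · exact absurd rfl h0
    -- The number `1` is excluded: the length of a nonempty code is at least `4`, but here it is at
    -- most `2`.
    · have : (2 : M) + 2 ≤ 2 := by linear_combination hle + 4 * hj1
      exact absurd this (not_le.2 (lt_add_of_pos_right _ two_pos))
    · exact .inl rfl
    · exact .inr (.inl rfl)
  · right; right
    refine ⟨y, d, isSeq_iff.2 ⟨j, hj, ?_⟩, hy, hd, rfl⟩
    rw [len_four_mul hy hd] at hl
    exact mul_left_cancel₀ four_ne_zero hl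

theorem isSeq_two : IsSeq (2 : M) := by
  refine isSeq_iff.2 ⟨2, pow2_two, (isLen_iff.1 ⟨pow2_two.mul pow2_two, ?_, ?_⟩).symm⟩ <;>
    norm_num

theorem isSeq_three : IsSeq (3 : M) := by
  refine isSeq_iff.2 ⟨2, pow2_two, (isLen_iff.1 ⟨pow2_two.mul pow2_two, ?_, ?_⟩).symm⟩ <;>
    norm_num

theorem len_two : len (2 : M) = 4 :=
  (isLen_iff.1 ⟨by simpa [show (2 : M) * 2 = 4 by norm_num] using pow2_two.mul (pow2_two (M := M)),
    by norm_num, by norm_num⟩).symm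

theorem len_three : len (3 : M) = 4 :=
  (isLen_iff.1 ⟨by simpa [show (2 : M) * 2 = 4 by norm_num] using pow2_two.mul (pow2_two (M := M)),
    by norm_num, by norm_num⟩).symm

/-- In a proper factorization `cat u v`, already `u * len v` is at least `4`. -/
theorem isBlock_of_le_three {w : M} (hw : IsSeq w) (h0 : w ≠ 0) (h : w ≤ 3) : IsBlock w := by
  refine isBlock_iff.2 ⟨hw, h0, fun u v hu hv e => ?_⟩
  by_contra hn
  push Not at hn
  obtain ⟨j, hj, hl⟩ := isSeq_len_four hv hn.2
  have h₁ : 4 ≤ len v := by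
    rw [hl]
    linear_combination 4 * (hj.mul hj).1
  have h₂ := mul_le_mul' (one_le_iff_ne_zero.2 hn.1) h₁
  rw [one_mul] at h₂
  have h₃ : u * len v ≤ w := e ▸ le_self_add
  exact absurd ((h₂.trans h₃).trans h) (by norm_num)

theorem isBlock_two : IsBlock (2 : M) := isBlock_of_le_three isSeq_two two_ne_zero (by norm_num)

theorem isBlock_three : IsBlock (3 : M) := isBlock_of_le_three isSeq_three three_ne_zero le_rfl

/-- Appending the digits `0e` preserves irreducibility: a nonempty right factor ends in these
digits, so it is neither `2` nor `3`, and removing them leaves a factorization of `w`. -/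
theorem IsBlock.four_mul {w e : M} (hw : IsBlock w) (he : e ≤ 1) : IsBlock (4 * w + e) := by
  obtain ⟨h₁, h₂, h₃⟩ := isBlock_iff.1 hw
  have he3 : e ≤ 3 := he.trans (by norm_num)
  refine isBlock_iff.2 ⟨isSeq_four_mul h₁ h₂ he3, ?_, fun u v hu hv h => ?_⟩
  · exact fun h => mul_ne_zero four_ne_zero h₂ (add_eq_zero.1 h).1
  by_contra hn
  push Not at hn
  have key : ∀ {d : M}, d ≤ 3 → 1 < d → ∀ y : M, 4 * w + e ≠ 4 * y + d := by
    intro d hd h1 y h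
    rw [← (four_mul_add_inj he3 hd h).2] at h1
    exact absurd h1 (not_lt.2 he)
  rcases hv.four_mul_cases hn.2 with rfl | rfl | ⟨y, d, hy, hy0, hd, rfl⟩
  · refine key (d := 2) (by norm_num) one_lt_two u ?_
    rw [h, cat, len_two, mul_comm]
  · refine key (d := 3) le_rfl (by norm_num) u ?_
    rw [h, cat, len_three, mul_comm]
  · rw [cat, len_four_mul hy0 hd] at h
    obtain ⟨rfl, -⟩ := four_mul_add_inj (y := cat u y) he3 hd (by rw [h, cat]; ring)
    rcases h₃ u y hu hy rfl with h | h
    · exact hn.1 h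
    · exact hy0 h

/-- A last pair `10` or `11` after a nonempty code would split off as the factor `2` or `3`. The
rest `y` is irreducible since any factorization of it extends to one of `w`. -/
theorem IsBlock.cases {w : M} (hw : IsBlock w) :
    w = 2 ∨ w = 3 ∨ ∃ y e, IsBlock y ∧ e ≤ 1 ∧ w = 4 * y + e := by
  obtain ⟨h₁, h₂, h₃⟩ := isBlock_iff.1 hw
  rcases h₁.four_mul_cases h₂ with h | h | ⟨y, d, hy, hy0, hd, rfl⟩
  · exact .inl h
  · exact .inr (.inl h)
  right; right
  have hd1 : d ≤ 1 := by
    rcases le_three_iff.1 hd with rfl | rfl | rfl | rfl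
    · exact zero_le_one
    · exact le_rfl
    · rcases h₃ y 2 hy isSeq_two (by rw [cat, len_two, mul_comm]) with h | h
      · exact absurd h hy0
      · exact absurd h two_ne_zero
    · rcases h₃ y 3 hy isSeq_three (by rw [cat, len_three, mul_comm]) with h | h
      · exact absurd h hy0
      · exact absurd h three_ne_zero
  refine ⟨y, d, isBlock_iff.2 ⟨hy, hy0, fun u v hu hv h => ?_⟩, hd1, rfl⟩
  by_contra hn
  push Not at hn
  have hv4 : 4 * v + d ≠ 0 := fun h => mul_ne_zero four_ne_zero hn.2 (add_eq_zero.1 h).1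
  rcases h₃ u (4 * v + d) hu (isSeq_four_mul hv hn.2 hd)
    (by rw [h, cat, cat, len_four_mul hn.2 hd]; ring) with h | h
  · exact hn.1 h
  · exact hv4 h

/-! ### The number coded by a block -/

theorem codes_iff {n w : M} :
    Codes n w ↔ ∃ h, Pow2 h ∧ h ≤ n + 2 ∧ n + 2 < 2 * h ∧ len w = h * h ∧
      ∀ q, Pow2 q → q < h → (Bit q (n + 2) ↔ Bit (q * q) w) := by
  have e : n + 1 + 1 = n + 2 := by rw [add_assoc, one_add_one_eq_two]
  constructor
  · rintro ⟨h, h₁, h₂, h₃, h₄, h₅⟩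
    rw [e] at *
    exact ⟨h, h₂, h₁, lt_iff_add_one_le.2 (by rwa [two_mul]), (isLen_iff.1 h₄).symm,
      fun q hq hlt => h₅ q hlt.le hq (lt_iff_add_one_le.1 hlt)⟩
  · rintro ⟨h, h₂, h₁, h₃, h₄, h₅⟩
    unfold Codes
    rw [e]
    exact ⟨h, h₁, h₂, by rw [← two_mul]; exact lt_iff_add_one_le.1 h₃, isLen_iff.2 h₄.symm,
      fun q _ hq hlt => h₅ q hq (lt_iff_add_one_le.2 hlt)⟩

theorem Pow2.lt_two {q : M} (h : q < 2) (hq : Pow2 q) : q = 1 :=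
  le_antisymm (lt_two_iff.1 h) hq.1

theorem codes_base_iff {e n : M} (he : e ≤ 1) : Codes n (2 + e) ↔ n = e := by
  have hl : len (2 + e) = 4 := by
    rcases le_one_iff.1 he with rfl | rfl
    · rw [add_zero, len_two]
    · rw [two_add_one_eq_three, len_three]
  rw [codes_iff]
  constructor
  · rintro ⟨h, h₁, h₂, h₃, h₄, h₅⟩
    have h2 : h = 2 := mul_self_inj' (by rw [← h₄, hl]; norm_num)
    subst h2
    have hn : n ≤ 1 := by
      have := lt_iff_add_one_le.1 h₃
      linear_combination this
    have := h₅ 1 Pow2.one one_lt_two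
    rw [mul_one, add_comm n, ← mul_one 2, bit_one hn, bit_one he] at this
    rcases le_one_iff.1 hn with rfl | rfl
    · rcases le_one_iff.1 he with rfl | rfl
      · rfl
      · exact this.2 rfl
    · exact (this.1 rfl).symm
  · rintro rfl
    refine ⟨2, pow2_two, le_add_self, ?_, by rw [hl]; norm_num, fun q hq hlt => ?_⟩
    · rw [lt_iff_add_one_le]
      linear_combination he
    · rw [hq.lt_two hlt, mul_one, add_comm]

/-- Appending `0e` to `w` corresponds to appending the digit `e` to `n + 2`, that is, `m + 2 = 2 *
(n + 2) + e`. -/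
theorem codes_four_mul_iff {m w e : M} (h0 : w ≠ 0) (he : e ≤ 1) :
    Codes m (4 * w + e) ↔ ∃ n, m = 2 * n + 2 + e ∧ Codes n w := by
  have he3 : e ≤ 3 := he.trans (by norm_num)
  simp only [codes_iff, len_four_mul h0 he3]
  constructor
  · rintro ⟨h, h₁, h₂, h₃, h₄, h₅⟩
    rcases h₁.eq_one_or_double with rfl | ⟨g, hg, rfl⟩
    · have := mul_le_mul_right (pow2_len w).1 4
      rw [h₄] at this
      exact absurd this (by norm_num)
    have hw : len w = g * g := mul_left_cancel₀ four_ne_zero (by rw [h₄]; ring)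
    obtain ⟨y, d, hd, hm⟩ := exists_two_mul_add (m + 2)
    rw [hm] at h₂ h₃ h₅
    have hg1 : (1 : M) < g := by
      by_contra h
      have := two_le_len h0
      have hg' := le_antisymm (not_lt.1 h) hg.1
      rw [hw, hg', mul_one] at this
      exact absurd this (by norm_num)
    have hgy : g ≤ y := by
      by_contra h
      have := lt_iff_add_one_le.1 (not_le.1 h)
      have : 1 + 1 ≤ (1 : M) := by linear_combination 2 * this + h₂ + hd
      exact absurd this (not_le.2 (lt_add_of_pos_right _ zero_lt_one))
    -- The quotient `y` must have the form `n + 2`; this follows from `w ≠ 0`, which forces `g > 1`.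
    have hy : 2 ≤ y := by
      have := lt_iff_add_one_le.1 hg1
      rw [one_add_one_eq_two] at this
      exact this.trans hgy
    obtain ⟨n, rfl⟩ := exists_add_of_le hy
    have hde : d = e := by
      have := h₅ 1 Pow2.one (hg1.trans_le (by rw [two_mul]; exact le_self_add))
      rw [mul_one, bit_one hd, bit_one_four he] at this
      rcases le_one_iff.1 hd with rfl | rfl
      · rcases le_one_iff.1 he with rfl | rfl
        · rfl
        · exact this.2 rfl
      · exact (this.1 rfl).symm
    subst hde
    refine ⟨n, ?_, g, hg, by rwa [add_comm], ?_, hw, fun q hq hlt => ?_⟩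
    · apply add_right_cancel (b := 2)
      rw [hm]
      ring
    · rw [add_comm]
      by_contra h
      have := mul_le_mul_right (not_lt.1 h) 2
      exact absurd h₃ (not_lt.2 (this.trans le_self_add))
    · have := h₅ (2 * q) (pow2_two.mul hq) (mul_lt_mul_of_pos_left hlt two_pos)
      rw [bit_two_mul hq.ne_zero hd,
        show 2 * q * (2 * q) = 4 * (q * q) by ring,
        bit_four_mul (mul_ne_zero hq.ne_zero hq.ne_zero) hd] at this
      rwa [add_comm n]
  · rintro ⟨n, rfl, h, h₁, h₂, h₃, h₄, h₅⟩
    have e₁ : 2 * n + 2 + e + 2 = 2 * (n + 2) + e := by ring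
    rw [e₁]
    refine ⟨2 * h, pow2_two.mul h₁, ?_, ?_, by rw [h₄]; ring, fun q hq hlt => ?_⟩
    · exact (mul_le_mul_right h₂ 2).trans le_self_add
    · have := lt_iff_add_one_le.1 h₃
      rw [lt_iff_add_one_le]
      linear_combination 2 * this + he
    -- The last digit is `e` on both sides. The other digits move up by one place in `n + 2` and by
    -- two places in `w`.
    · rcases hq.eq_one_or_double with rfl | ⟨r, hr, rfl⟩
      · rw [mul_one, bit_one he, bit_one_four he]
      · rw [bit_two_mul hr.ne_zero he,
          show 2 * r * (2 * r) = 4 * (r * r) by ring,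
          bit_four_mul (mul_ne_zero hr.ne_zero hr.ne_zero) he]
        exact h₅ r hr (lt_of_mul_lt_mul_left hlt zero_le)

theorem codes_two {n : M} : Codes n 2 ↔ n = 0 := by
  simpa using codes_base_iff (n := n) (e := 0) zero_le_one

theorem codes_three {n : M} : Codes n 3 ↔ n = 1 := by
  simpa [two_add_one_eq_three] using codes_base_iff (n := n) (e := 1) le_rfl

theorem codes_eight {n : M} : Codes n 8 ↔ n = 2 := by
  have : (8 : M) = 4 * 2 + 0 := by norm_num
  rw [this, codes_four_mul_iff two_ne_zero zero_le_one]
  simp [codes_two]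

theorem isBlock_eight : IsBlock (8 : M) := by
  have : (8 : M) = 4 * 2 + 0 := by norm_num
  rw [this]
  exact isBlock_two.four_mul zero_le_one

/-- Needed to see that a nonempty code has a term. The bound `n ≤ w` keeps the induction predicate
bounded. -/
theorem IsBlock.exists_codes {w : M} (hw : IsBlock w) : ∃ n, Codes n w := by
  have : IsBlock w → ∃ n ≤ w, Codes n w := by
    refine sigma0_strong_induction (P := fun w : M => IsBlock w → ∃ n ≤ w, Codes n w)
      (fun w ih hw => ?_) w
    rcases hw.cases with rfl | rfl | ⟨y, e, hy, he, rfl⟩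
    · exact ⟨0, zero_le, codes_two.2 rfl⟩
    · exact ⟨1, by norm_num, codes_three.2 rfl⟩
    · have h1 := one_le_iff_ne_zero.2 hy.2.1
      have hlt : y < 4 * y + e := by
        rw [lt_iff_add_one_le]
        have h₁ : (0 : M) ≤ 2 * y + e := zero_le
        linear_combination h1 + h₁
      obtain ⟨n, hn, hc⟩ := ih y hlt hy
      refine ⟨2 * n + 2 + e, ?_, (codes_four_mul_iff hy.2.1 he).2 ⟨n, rfl, hc⟩⟩
      linear_combination 2 * hn + 2 * h1
  obtain ⟨n, -, h⟩ := this hw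
  exact ⟨n, h⟩

/-- Sequences of ones and twos need uniqueness of the block only for the values `1` and `2`; the
value `0` enters because `8 = 4 * 2 + 0`. -/
theorem eq_of_codes_zero {w : M} (hw : IsBlock w) (h : Codes 0 w) : w = 2 := by
  rcases hw.cases with rfl | rfl | ⟨y, e, hy, he, rfl⟩
  · rfl
  · exact absurd (codes_three.1 h) zero_ne_one
  · obtain ⟨n, hn, -⟩ := (codes_four_mul_iff hy.2.1 he).1 h
    exact absurd (add_eq_zero.1 (add_eq_zero.1 hn.symm).1).2 two_ne_zero

theorem eq_of_codes_one {w : M} (hw : IsBlock w) (h : Codes 1 w) : w = 3 := by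
  rcases hw.cases with rfl | rfl | ⟨y, e, hy, he, rfl⟩
  · exact absurd (codes_two.1 h) one_ne_zero
  · rfl
  · obtain ⟨n, hn, -⟩ := (codes_four_mul_iff hy.2.1 he).1 h
    have h₁ : (0 : M) ≤ 2 * n + e := zero_le
    have : (2 : M) ≤ 1 := by linear_combination h₁ + hn.symm
    exact absurd this (by norm_num)

theorem eq_of_codes_two {w : M} (hw : IsBlock w) (h : Codes 2 w) : w = 8 := by
  rcases hw.cases with rfl | rfl | ⟨y, e, hy, he, rfl⟩
  · exact absurd (codes_two.1 h) two_ne_zero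
  · exact absurd (codes_three.1 h) (by norm_num)
  · obtain ⟨n, hn, hc⟩ := (codes_four_mul_iff hy.2.1 he).1 h
    have : 2 * n + e = 0 := by linear_combination -hn
    obtain ⟨h₁, rfl⟩ := add_eq_zero.1 this
    have : n = 0 := by simpa using h₁
    subst this
    rw [eq_of_codes_zero hy hc]
    norm_num

end Model

/-! ### Semantics of quantifiers over named variables -/

section Semantics

variable {L : FirstOrder.Language.{0, 0}} {N : Type} [L.Structure N] {α : Type} [DecidableEq α]

theorem realize_relabel_named (i : α) (φ : L.Formula α) (v : α → N) (a : N) :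
    (BoundedFormula.relabel (fun j => if j = i then Sum.inr (0 : Fin 1) else Sum.inl j) φ :
      L.BoundedFormula α 1).Realize v (Fin.snoc default a) ↔
      φ.Realize (Function.update v i a) := by
  rw [BoundedFormula.realize_relabel, Formula.Realize, iff_iff_eq]
  congr 1
  · funext j
    by_cases h : j = i
    · subst h
      simp [Fin.snoc]
    · simp [h]
  · exact Subsingleton.elim _ _

@[simp] theorem realize_allv (i : α) (φ : L.Formula α) (v : α → N) :
    (allv i φ).Realize v ↔ ∀ a, φ.Realize (Function.update v i a) := by
  simp only [allv, Formula.Realize, BoundedFormula.realize_all]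
  exact forall_congr' fun a => realize_relabel_named i φ v a

@[simp] theorem realize_exv (i : α) (φ : L.Formula α) (v : α → N) :
    (exv i φ).Realize v ↔ ∃ a, φ.Realize (Function.update v i a) := by
  simp only [exv, Formula.Realize, BoundedFormula.realize_ex]
  exact exists_congr fun a => realize_relabel_named i φ v a

theorem realize_formula_subst {β : Type} (φ : L.Formula α) (f : α → L.Term β) (v : β → N) :
    Formula.Realize (φ.subst f : L.Formula β) v ↔ φ.Realize (fun a => (f a).realize v) :=
  BoundedFormula.realize_subst

@[simp] theorem realize_substv (i : α) (t : L.Term α) (φ : L.Formula α) (v : α → N) :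
    (substv i t φ).Realize v ↔ φ.Realize (Function.update v i (t.realize v)) := by
  rw [substv, realize_formula_subst, iff_iff_eq]
  congr 1
  funext j
  by_cases h : j = i
  · subst h
    simp
  · simp [h]

theorem realize_univClosure {k : ℕ} (φ : L.Formula (Fin k)) :
    N ⊨ univClosure φ ↔ ∀ v : Fin k → N, φ.Realize v := by
  rw [univClosure, Sentence.Realize, Formula.realize_iAlls]
  refine forall_congr' fun v => ?_
  rw [Formula.realize_relabel]
  rfl

end Semantics

/-! ### The models of `IΣ₀` -/

section Models

variable {M : Type} [arith.Structure M]

theorem exists_sigma0Model (h : M ⊨ ISigma0) :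
    ∃ (_ : Zero M) (_ : One M) (_ : Add M) (_ : Mul M) (_ : LE M), Sigma0Model M := by
  let z : M := Structure.funMap (L := arith) ArithFunc.zero ![]
  let s : M → M := fun x => Structure.funMap (L := arith) ArithFunc.succ ![x]
  let a : M → M → M := fun x y => Structure.funMap (L := arith) ArithFunc.add ![x, y]
  let m : M → M → M := fun x y => Structure.funMap (L := arith) ArithFunc.mul ![x, y]
  have rz : ∀ {α : Type} (v : α → M), (Ar.zero : arith.Term α).realize v = z := fun v =>
    congrArg (Structure.funMap (L := arith) ArithFunc.zero) (Subsingleton.elim _ _)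
  have rs : ∀ {α : Type} (v : α → M) (t : arith.Term α),
      (Ar.succ t).realize v = s (t.realize v) := fun v t =>
    congrArg (Structure.funMap (L := arith) ArithFunc.succ) (funext fun i => by fin_cases i; rfl)
  have ra : ∀ {α : Type} (v : α → M) (t u : arith.Term α),
      (Ar.add t u).realize v = a (t.realize v) (u.realize v) := fun v t u =>
    congrArg (Structure.funMap (L := arith) ArithFunc.add) (funext fun i => by fin_cases i <;> rfl)
  have rm : ∀ {α : Type} (v : α → M) (t u : arith.Term α),
      (Ar.mul t u).realize v = m (t.realize v) (u.realize v) := fun v t u =>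
    congrArg (Structure.funMap (L := arith) ArithFunc.mul) (funext fun i => by fin_cases i <;> rfl)
  have hQ : ∀ φ : arith.Formula (Fin 2), univClosure φ ∈ Ar.Q → ∀ x y : M, φ.Realize ![x, y] :=
    fun φ hφ x y => realize_univClosure φ |>.1 (h.realize_of_mem _ (Or.inl hφ)) _
  have q₁ : ∀ x, s x ≠ z := fun x => by
    simpa [Ar.x, rs, rz] using hQ (∼(Ar.succ Ar.x ≐ Ar.zero)) (by simp [Ar.Q]) x x
  have q₂ : ∀ x y, s x = s y → x = y := fun x y => by
    simpa [Ar.x, Ar.y, rs, rz] using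
      hQ ((Ar.succ Ar.x ≐ Ar.succ Ar.y) ⟹ (Ar.x ≐ Ar.y)) (by simp [Ar.Q]) x y
  have q₃ : ∀ x, x = z ∨ ∃ y, s y = x := fun x => by
    simpa [Ar.x, Ar.y, rs, rz] using
      hQ ((Ar.x ≐ Ar.zero) ⊔ exv 1 (Ar.succ Ar.y ≐ Ar.x)) (by simp [Ar.Q]) x x
  have q₄ : ∀ x, a x z = x := fun x => by
    simpa [Ar.x, Ar.y, ra, rz] using hQ (Ar.add Ar.x Ar.zero ≐ Ar.x) (by simp [Ar.Q]) x x
  have q₅ : ∀ x y, a x (s y) = s (a x y) := fun x y => by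
    simpa [Ar.x, Ar.y, ra, rs] using
      hQ (Ar.add Ar.x (Ar.succ Ar.y) ≐ Ar.succ (Ar.add Ar.x Ar.y)) (by simp [Ar.Q]) x y
  have q₆ : ∀ x, m x z = z := fun x => by
    simpa [Ar.x, Ar.y, rm, rz] using hQ (Ar.mul Ar.x Ar.zero ≐ Ar.zero) (by simp [Ar.Q]) x x
  have q₇ : ∀ x y, m x (s y) = a (m x y) x := fun x y => by
    simpa [Ar.x, Ar.y, rm, ra, rs] using
      hQ (Ar.mul Ar.x (Ar.succ Ar.y) ≐ Ar.add (Ar.mul Ar.x Ar.y) Ar.x) (by simp [Ar.Q]) x y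
  -- With `1` taken to be `0'`, the successor is `x + 1`, as the class `Sigma0Model` expects.
  have hs : ∀ x, a x (s z) = s x := fun x => by rw [q₅, q₄]
  let iz : Zero M := ⟨z⟩
  let io : One M := ⟨s z⟩
  let ia : Add M := ⟨a⟩
  let im : Mul M := ⟨m⟩
  let il : LE M := ⟨fun x y => ∃ w, a w x = y⟩
  refine ⟨iz, io, ia, im, il, ?_⟩
  exact
    { funMap_zero := fun v => congrArg _ (Subsingleton.elim _ _)
      funMap_succ := fun v => by
        refine Eq.trans ?_ (hs (v 0)).symm
        refine congrArg _ (funext fun i => ?_)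
        fin_cases i
        rfl
      funMap_add := fun v => congrArg _ (funext fun i => by fin_cases i <;> rfl)
      funMap_mul := fun v => congrArg _ (funext fun i => by fin_cases i <;> rfl)
      le_def := fun x y => Iff.rfl
      add_one_ne_zero' := fun x h => q₁ x ((hs x).symm.trans h)
      add_one_inj' := fun {x y} h => q₂ x y ((hs x).symm.trans (h.trans (hs y)))
      exists_add_one' := fun x => (q₃ x).imp_right fun ⟨y, hy⟩ => ⟨y, (hs y).trans hy⟩
      add_zero' := q₄
      add_add_one' := fun x y => by
        change a x (a y (s z)) = a (a x y) (s z)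
        rw [hs, hs, q₅]
      mul_zero' := q₆
      mul_add_one' := fun x y => by
        change m x (a y (s z)) = a (m x y) x
        rw [hs, q₇]
      one_def := by
        change s z = a z (s z)
        rw [hs]
      ind := fun {k} i φ hφ v h0 h1 x => by
        have := realize_univClosure _ |>.1
          (h.realize_of_mem _ (Or.inr ⟨k, i, φ, hφ, rfl⟩ : Ar.ind i φ ∈ ISigma0)) v
        simp only [Formula.realize_imp, Formula.realize_inf, realize_substv, realize_allv, rz, rs,
          Term.realize_var, Function.update_self, Function.update_idem] at this
        refine this ⟨h0, fun x hx => ?_⟩ x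
        have := h1 x hx
        change φ.Realize (Function.update v i (a x (s z))) at this
        rwa [hs] at this }

theorem models_of_forall_realize {α : Type} {φ : arith.Formula α}
    (h : ∀ (M : Type) [CommSemiring M] [LinearOrder M] [IsStrictOrderedRing M]
      [CanonicallyOrderedAdd M] [arith.Structure M] [Sigma0Model M] (v : α → M), φ.Realize v) :
    ISigma0 ⊨ᵇ φ := by
  intro N v xs
  obtain ⟨_, _, _, _, _, _⟩ := exists_sigma0Model (M := N) N.is_model
  obtain ⟨_, _, _, _, _⟩ := Sigma0Model.exists_orderedSemiring N
  have := h N v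
  rwa [Formula.Realize, Subsingleton.elim default xs] at this

instance : Sigma0Model ℕ where
  funMap_zero _ := rfl
  funMap_succ _ := rfl
  funMap_add _ := rfl
  funMap_mul _ := rfl
  le_def x y := le_iff_exists_add'.trans ⟨fun ⟨c, h⟩ => ⟨c, h.symm⟩, fun ⟨c, h⟩ => ⟨c, h.symm⟩⟩
  add_one_ne_zero' := Nat.succ_ne_zero
  add_one_inj' := Nat.succ.inj
  exists_add_one' x := by
    cases x with
    | zero => exact .inl rfl
    | succ n => exact .inr ⟨n, rfl⟩
  add_zero' _ := rfl
  add_add_one' _ _ := rfl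
  mul_zero' _ := rfl
  mul_add_one' _ _ := rfl
  one_def := rfl
  ind _ _ _ _ h0 h1 x := by
    induction x with
    | zero => exact h0
    | succ n ih => exact h1 n ih

end Models

/-! ### The formulas of the coding -/

/-- A model of `IΣ₀` together with `k` of its elements. -/
structure PointedModel (k : ℕ) where
  /-- The carrier. -/
  carrier : Type
  [semiring : CommSemiring carrier]
  [order : LinearOrder carrier]
  [strict : IsStrictOrderedRing carrier]
  [canonical : CanonicallyOrderedAdd carrier]
  [struct : arith.Structure carrier]
  [model : Sigma0Model carrier]
  /-- The distinguished elements. -/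
  point : Fin k → carrier

attribute [instance] PointedModel.semiring PointedModel.order PointedModel.strict
  PointedModel.canonical PointedModel.struct PointedModel.model

section Formulas

variable {M : Type} [CommSemiring M] [LinearOrder M] [IsStrictOrderedRing M]
  [CanonicallyOrderedAdd M] [arith.Structure M] [Sigma0Model M]

/-- Bounded formulas without parameters. -/
abbrev Sigma0Rel {k : ℕ} (P : PointedModel k → Prop) : Prop :=
  Sigma0Def (S := PointedModel.carrier) (α := Fin k) (fun A => A.point)
    (fun A (_ : Fin 0 → A.carrier) => P A)

instance {k n : ℕ} (j : Fin k) :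
    TermDef (S := PointedModel.carrier) (α := Fin k) (fun A => A.point)
      (fun A (_ : Fin n → A.carrier) => A.point j) :=
  TermDef.free (S := PointedModel.carrier) (env := fun A => A.point) j

/-- The formula given by the definability of a relation. -/
noncomputable def Sigma0Rel.formula {k : ℕ} {P : PointedModel k → Prop} (h : Sigma0Rel P) :
    arith.Formula (Fin k) := h.exists_formula.choose

theorem Sigma0Rel.isSigma0 {k : ℕ} {P : PointedModel k → Prop} (h : Sigma0Rel P) :
    Ar.IsSigma0 h.formula := h.exists_formula.choose_spec.1

/-- Definability over the family of all pointed models at once provides one formula that serves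
every model. -/
theorem Sigma0Rel.realize {k : ℕ} {P : PointedModel k → Prop} (h : Sigma0Rel P)
    (v : Fin k → M) : h.formula.Realize v ↔ P ⟨M, v⟩ :=
  h.exists_formula.choose_spec.2 ⟨M, v⟩ default

theorem sigma0Rel_isSeq : Sigma0Rel (k := 1) (fun A => IsSeq (A.point 0)) := inferInstance

theorem sigma0Rel_mem : Sigma0Rel (k := 2) (fun A => Mem (A.point 0) (A.point 1)) := inferInstance

theorem sigma0Rel_catRel :
    Sigma0Rel (k := 3) (fun A => CatRel (A.point 0) (A.point 1) (A.point 2)) := inferInstance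

/-- The coding of sequences by binary strings of even length. -/
noncomputable def binaryCoding : SeqCoding where
  seq := sigma0Rel_isSeq.formula
  mem := sigma0Rel_mem.formula
  cat := sigma0Rel_catRel.formula
  -- This is `x * len y + y` with `len y` replaced by its upper bound `2 * y + 1`.
  bound := Ar.add (Ar.mul Ar.x (Ar.succ (Ar.add Ar.y Ar.y))) Ar.y
  -- The values are `3` and `8`, in binary `11` and `1000`: the expansions `11` and `100` of `1 + 2`
  -- and `2 + 2`, with a `0` inserted before every digit after the second.
  c₁ := Ar.succ Ar.two
  c₂ := Ar.mul Ar.two (Ar.mul Ar.two Ar.two)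

variable {α : Type} (v : α → M)

@[simp] theorem realize_seq (v : Fin 1 → M) : binaryCoding.seq.Realize v ↔ IsSeq (v 0) :=
  sigma0Rel_isSeq.realize v

@[simp] theorem realize_mem (v : Fin 2 → M) : binaryCoding.mem.Realize v ↔ Mem (v 0) (v 1) :=
  sigma0Rel_mem.realize v

@[simp] theorem realize_cat (v : Fin 3 → M) :
    binaryCoding.cat.Realize v ↔ CatRel (v 0) (v 1) (v 2) :=
  sigma0Rel_catRel.realize v

@[simp] theorem realize_Seq (t : arith.Term α) :
    (binaryCoding.Seq t).Realize v ↔ IsSeq (t.realize v) :=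
  (realize_formula_subst _ _ _).trans (realize_seq _)

@[simp] theorem realize_Mem (t u : arith.Term α) :
    (binaryCoding.Mem t u).Realize v ↔ Mem (t.realize v) (u.realize v) :=
  (realize_formula_subst _ _ _).trans (realize_mem _)

@[simp] theorem realize_Cat (t u w : arith.Term α) :
    (binaryCoding.Cat t u w).Realize v ↔ CatRel (t.realize v) (u.realize v) (w.realize v) :=
  (realize_formula_subst _ _ _).trans (realize_cat _)

@[simp] theorem realize_c₁ (v : Empty → M) : binaryCoding.c₁.realize v = 3 := by
  have : (1 : M) + 1 + 1 = 3 := by norm_num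
  simpa [binaryCoding] using this

@[simp] theorem realize_c₂ (v : Empty → M) : binaryCoding.c₂.realize v = 8 := by
  have : (1 + 1 : M) * ((1 + 1) * (1 + 1)) = 8 := by norm_num
  simpa [binaryCoding] using this

@[simp] theorem realize_k₁ : (binaryCoding.k₁ : arith.Term α).realize v = 3 := by
  simp [SeqCoding.k₁]

@[simp] theorem realize_k₂ : (binaryCoding.k₂ : arith.Term α).realize v = 8 := by
  simp [SeqCoding.k₂]

/-- `x` codes a nonempty sequence whose terms are `1` or `2`. -/
def IsStar (x : M) : Prop := IsSeq x ∧ (∃ y, Mem y x) ∧ ∀ y, Mem y x → y = 1 ∨ y = 2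

@[simp] theorem realize_seqStar (v : Fin 1 → M) :
    binaryCoding.seqStar.Realize v ↔ IsStar (v 0) := by
  have key : ∀ a : M, (BoundedFormula.relabel (n := 1) (k := 0) ![Sum.inr 0, Sum.inl 0]
      binaryCoding.mem : arith.BoundedFormula (Fin 1) 1).Realize v (Fin.snoc default a) ↔
      Mem a (v 0) := by
    intro a
    rw [BoundedFormula.realize_relabel]
    exact (iff_of_eq (congrArg (BoundedFormula.Realize _ _) (Subsingleton.elim _ _))).trans
      (realize_mem _)
  simp only [SeqCoding.seqStar, IsStar, Formula.Realize, BoundedFormula.realize_inf,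
    BoundedFormula.realize_ex, BoundedFormula.realize_all, BoundedFormula.realize_imp, key,
    BoundedFormula.realize_sup, BoundedFormula.realize_bdEqual, realize_one, realize_two,
    one_add_one_eq_two]
  rw [and_assoc]
  exact and_congr (realize_seq v) Iff.rfl

@[simp] theorem realize_SeqStar (t : arith.Term α) :
    (binaryCoding.SeqStar t).Realize v ↔ IsStar (t.realize v) :=
  (realize_formula_subst _ _ _).trans (realize_seqStar _)

/-- `x` codes the sequence `⟨c⟩`. -/
def IsSingle (x c : M) : Prop :=
  IsStar x ∧ (∀ p, Mem p x ↔ p = c) ∧ ¬ ∃ p q, IsStar p ∧ IsStar q ∧ CatRel p q x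

end Formulas

/-! ### Sequences of ones and twos -/

section Model

variable {M : Type} [CommSemiring M] [LinearOrder M] [IsStrictOrderedRing M]
  [CanonicallyOrderedAdd M] [arith.Structure M] [Sigma0Model M]

theorem IsStar.ne_zero {s : M} (hs : IsStar s) : s ≠ 0 := by
  rintro rfl
  obtain ⟨y, hy⟩ := hs.2.1
  exact not_mem_zero y hy

theorem IsStar.cat {s t : M} (hs : IsStar s) (ht : IsStar t) : IsStar (cat s t) := by
  refine ⟨hs.1.cat ht.1, ?_, fun y hy => ?_⟩
  · obtain ⟨y, hy⟩ := hs.2.1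
    exact ⟨y, (mem_cat hs.1 ht.1).2 (.inl hy)⟩
  · rcases (mem_cat hs.1 ht.1).1 hy with h | h
    · exact hs.2.2 y h
    · exact ht.2.2 y h

/-- The first block codes some number, which is then a term. -/
theorem isStar_of_ne_zero {s : M} (hs : IsSeq s) (h0 : s ≠ 0)
    (h : ∀ y, Mem y s → y = 1 ∨ y = 2) : IsStar s := by
  obtain ⟨w, t, hw, ht, rfl⟩ := exists_first_block hs h0
  obtain ⟨n, hn⟩ := hw.exists_codes
  exact ⟨hs, ⟨n, (mem_cat hw.1 ht).2 (.inl ((mem_block hw).2 hn))⟩, h⟩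

theorem isStar_three : IsStar (3 : M) :=
  isStar_of_ne_zero isSeq_three three_ne_zero fun _ hy =>
    .inl (codes_three.1 ((mem_block isBlock_three).1 hy))

theorem isStar_eight : IsStar (8 : M) :=
  isStar_of_ne_zero isBlock_eight.1 isBlock_eight.2.1 fun _ hy =>
    .inr (codes_eight.1 ((mem_block isBlock_eight).1 hy))

theorem IsBlock.eq_of_mem {w : M} (hw : IsBlock w) (h : ∀ y, Mem y w → y = 1 ∨ y = 2) :
    w = 3 ∨ w = 8 := by
  obtain ⟨n, hn⟩ := hw.exists_codes
  rcases h n ((mem_block hw).2 hn) with rfl | rfl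
  · exact .inl (eq_of_codes_one hw hn)
  · exact .inr (eq_of_codes_two hw hn)

theorem IsStar.first {s : M} (hs : IsStar s) :
    (s = 3 ∨ s = 8) ∨ ∃ w t, (w = 3 ∨ w = 8) ∧ IsStar t ∧ s = ConcatArith.cat w t := by
  obtain ⟨w, t, hw, ht, rfl⟩ := exists_first_block hs.1 hs.ne_zero
  have h : ∀ y, Mem y w ∨ Mem y t → y = 1 ∨ y = 2 := fun y hy =>
    hs.2.2 y ((mem_cat hw.1 ht).2 hy)
  have hw' := hw.eq_of_mem fun y hy => h y (.inl hy)
  rcases eq_or_ne t 0 with rfl | h0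
  · rw [cat_zero]
    exact .inl hw'
  · exact .inr ⟨w, t, hw', isStar_of_ne_zero ht h0 fun y hy => h y (.inr hy), rfl⟩

theorem IsStar.last {s : M} (hs : IsStar s) :
    (s = 3 ∨ s = 8) ∨ ∃ w t, (w = 3 ∨ w = 8) ∧ IsStar t ∧ s = ConcatArith.cat t w := by
  obtain ⟨w, t, hw, ht, rfl⟩ := exists_last_block hs.1 hs.ne_zero
  have h : ∀ y, Mem y t ∨ Mem y w → y = 1 ∨ y = 2 := fun y hy =>
    hs.2.2 y ((mem_cat ht hw.1).2 hy)
  have hw' := hw.eq_of_mem fun y hy => h y (.inr hy)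
  rcases eq_or_ne t 0 with rfl | h0
  · rw [zero_cat]
    exact .inl hw'
  · exact .inr ⟨w, t, hw', isStar_of_ne_zero ht h0 fun y hy => h y (.inl hy), rfl⟩

theorem IsStar.cat_not_isBlock {s t : M} (hs : IsStar s) (ht : IsStar t) :
    ¬ IsBlock (ConcatArith.cat s t) := fun h =>
  ((isBlock_iff.1 h).2.2 s t hs.1 ht.1 rfl).elim hs.ne_zero ht.ne_zero

/-- By Levi's lemma one block begins with the other, and irreducibility makes the remaining piece
empty. -/
theorem IsBlock.eq_of_cat_eq {w z s t : M} (hw : IsBlock w) (hz : IsBlock z) (hs : IsSeq s)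
    (ht : IsSeq t) (h : ConcatArith.cat w s = ConcatArith.cat z t) : w = z := by
  rcases levi hs ht h with ⟨y, hy, h, -⟩ | ⟨y, hy, h, -⟩
  · rcases (isBlock_iff.1 hw).2.2 _ _ hz.1 hy h with h' | rfl
    · exact absurd h' hz.2.1
    · rwa [cat_zero] at h
  · rcases (isBlock_iff.1 hz).2.2 _ _ hw.1 hy h with h' | rfl
    · exact absurd h' hw.2.1
    · rw [cat_zero] at h
      exact h.symm

theorem IsBlock.eq_of_cat_eq' {w z s t : M} (hw : IsBlock w) (hz : IsBlock z)
    (h : ConcatArith.cat s w = ConcatArith.cat t z) : w = z := by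
  rcases levi hw.1 hz.1 h with ⟨y, hy, -, h⟩ | ⟨y, hy, -, h⟩
  · rcases (isBlock_iff.1 hz).2.2 _ _ hy hw.1 h with rfl | h'
    · rw [zero_cat] at h
      exact h.symm
    · exact absurd h' hw.2.1
  · rcases (isBlock_iff.1 hw).2.2 _ _ hy hz.1 h with rfl | h'
    · rwa [zero_cat] at h
    · exact absurd h' hz.2.1

theorem isSingle_three : IsSingle (3 : M) 1 := by
  refine ⟨isStar_three, fun p => (mem_block isBlock_three).trans codes_three, ?_⟩
  rintro ⟨p, q, hp, hq, h⟩
  exact hp.cat_not_isBlock hq ((catRel_iff hp.1 hq.1).1 h ▸ isBlock_three)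

theorem isSingle_eight : IsSingle (8 : M) 2 := by
  refine ⟨isStar_eight, fun p => (mem_block isBlock_eight).trans codes_eight, ?_⟩
  rintro ⟨p, q, hp, hq, h⟩
  exact hp.cat_not_isBlock hq ((catRel_iff hp.1 hq.1).1 h ▸ isBlock_eight)

/-- If more follows the first block, the string splits into two nonempty ones, which the last clause
of `IsSingle` forbids. -/
theorem IsSingle.eq_or {x c : M} (h : IsSingle x c) : x = 3 ∨ x = 8 := by
  rcases h.1.first with h' | ⟨w, t, hw, ht, rfl⟩
  · exact h'
  · have hw' : IsStar w := by
      rcases hw with rfl | rfl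
      · exact isStar_three
      · exact isStar_eight
    exact absurd ⟨w, t, hw', ht, (catRel_iff hw'.1 ht.1).2 rfl⟩ h.2.2

theorem IsSingle.eq_three {x : M} (h : IsSingle x 1) : x = 3 := by
  rcases h.eq_or with h' | rfl
  · exact h'
  · exact absurd ((isSingle_eight.2.1 1).1 ((h.2.1 1).2 rfl)) one_lt_two.ne

theorem IsSingle.eq_eight {x : M} (h : IsSingle x 2) : x = 8 := by
  rcases h.eq_or with rfl | h'
  · exact absurd ((isSingle_three.2.1 2).1 ((h.2.1 2).2 rfl)) one_lt_two.ne'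
  · exact h'

end Model

/-! ### The properties of the coding that `IΣ₀` proves -/

section Provable

variable {M : Type} [CommSemiring M] [LinearOrder M] [IsStrictOrderedRing M]
  [CanonicallyOrderedAdd M] [arith.Structure M] [Sigma0Model M]

theorem realize_leF {α : Type} (t u : arith.Term α) (v : α → M) :
    (Ar.leF t u).Realize v ↔ t.realize v ≤ u.realize v := by
  rw [Ar.leF, Formula.Realize, realize_le, Term.realize_relabel, Term.realize_relabel]
  rfl

theorem exists_unique_catRel (s t : M) : ∃ u, CatRel s t u ∧ ∀ p, CatRel s t p → p = u := by
  by_cases h : IsSeq s ∧ IsSeq t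
  · exact ⟨cat s t, (catRel_iff h.1 h.2).2 rfl, fun p => (catRel_iff h.1 h.2).1⟩
  · exact ⟨0, (catRel_of_not h).2 rfl, fun p => (catRel_of_not h).1⟩

theorem CatRel.le {s t u : M} (h : CatRel s t u) : u ≤ s * (t + t + 1) + t := by
  rcases h with ⟨-, -, q, hq, -, rfl⟩ | ⟨-, rfl⟩
  · gcongr
  · exact zero_le

open SeqCoding in
theorem models_catTotal : ISigma0 ⊨ᵇ binaryCoding.catTotal := by
  refine models_of_forall_realize fun M _ _ _ _ _ _ v => ?_
  simpa [catTotal, s, t, u, p] using exists_unique_catRel (v 0) (v 1)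

theorem realize_bound (v : Fin 2 → M) :
    binaryCoding.bound.realize v = v 0 * (v 1 + v 1 + 1) + v 1 := by
  simp [binaryCoding, Ar.x, Ar.y]

open SeqCoding in
theorem models_catBounded : ISigma0 ⊨ᵇ binaryCoding.catBounded := by
  refine models_of_forall_realize fun M _ _ _ _ _ _ v => ?_
  have : CatRel (v 0) (v 1) (v 2) → v 2 ≤ v 0 * (v 1 + v 1 + 1) + v 1 := CatRel.le
  simpa [catBounded, s, t, u, realize_leF, realize_bound] using this

open SeqCoding in
theorem models_catJunk : ISigma0 ⊨ᵇ binaryCoding.catJunk := by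
  refine models_of_forall_realize fun M _ _ _ _ _ _ v => ?_
  have := fun h => (catRel_of_not (s := v 0) (t := v 1) (u := 0) h).2 rfl
  simpa [catJunk, s, t, u, p] using this

open SeqCoding in
theorem models_t0 : ISigma0 ⊨ᵇ binaryCoding.t0 := by
  refine models_of_forall_realize fun M _ _ _ _ _ _ v => ?_
  simpa [t0, s] using ⟨(3 : M), isStar_three⟩

open SeqCoding in
theorem models_t1 : ISigma0 ⊨ᵇ binaryCoding.t1 := by
  refine models_of_forall_realize fun M _ _ _ _ _ _ v => ?_
  have : (∃ x : M, IsSingle x 1 ∧ ∀ y, IsSingle y 1 → y = x) ∧ IsSingle (3 : M) 1 :=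
    ⟨⟨3, isSingle_three, fun _ h => h.eq_three⟩, isSingle_three⟩
  simpa [t1, s, t, p, q, Single, IsSingle, and_assoc] using this

open SeqCoding in
theorem models_t2 : ISigma0 ⊨ᵇ binaryCoding.t2 := by
  refine models_of_forall_realize fun M _ _ _ _ _ _ v => ?_
  have : (∃ x : M, IsSingle x 2 ∧ ∀ y, IsSingle y 2 → y = x) ∧ IsSingle (8 : M) 2 :=
    ⟨⟨8, isSingle_eight, fun _ h => h.eq_eight⟩, isSingle_eight⟩
  simpa [t2, s, t, p, q, Single, IsSingle, and_assoc, one_add_one_eq_two] using this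

open SeqCoding in
theorem models_t3 : ISigma0 ⊨ᵇ binaryCoding.t3 := by
  refine models_of_forall_realize fun M _ _ _ _ _ _ v => ?_
  have : IsStar (v 0) → IsStar (v 1) → ∃ x, (IsStar x ∧ CatRel (v 0) (v 1) x) ∧
      ∀ y, IsStar y → CatRel (v 0) (v 1) y → y = x := fun h₁ h₂ =>
    ⟨cat (v 0) (v 1), ⟨h₁.cat h₂, (catRel_iff h₁.1 h₂.1).2 rfl⟩,
      fun y _ => (catRel_iff h₁.1 h₂.1).1⟩
  simpa [t3, s, t, u, p] using this

open SeqCoding in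
theorem models_t4 : ISigma0 ⊨ᵇ binaryCoding.t4 := by
  refine models_of_forall_realize fun M _ _ _ _ _ _ v => ?_
  have : IsStar (v 0) → IsStar (v 1) → IsStar (v 2) → ∃ x y z,
      ((CatRel (v 0) (v 1) x ∧ CatRel x (v 2) z) ∧ CatRel (v 1) (v 2) y) ∧ CatRel (v 0) y z :=
    fun h₀ h₁ h₂ => ⟨cat (v 0) (v 1), cat (v 1) (v 2), cat (cat (v 0) (v 1)) (v 2),
      ⟨⟨(catRel_iff h₀.1 h₁.1).2 rfl, (catRel_iff (h₀.1.cat h₁.1) h₂.1).2 rfl⟩,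
        (catRel_iff h₁.1 h₂.1).2 rfl⟩, (catRel_iff h₀.1 (h₁.1.cat h₂.1)).2 (cat_assoc _ _ _)⟩
  simpa [t4, s, t, u, p, q, r] using this

open SeqCoding in
theorem models_t5 : ISigma0 ⊨ᵇ binaryCoding.t5 := by
  refine models_of_forall_realize fun M _ _ _ _ _ _ v => ?_
  have : IsStar (v 0) → IsStar (v 1) → ¬ CatRel (v 0) (v 1) 3 ∧ ¬ CatRel (v 0) (v 1) 8 :=
    fun h₀ h₁ => by
      rw [catRel_iff h₀.1 h₁.1, catRel_iff h₀.1 h₁.1]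
      exact ⟨fun h => h₀.cat_not_isBlock h₁ (h ▸ isBlock_three),
        fun h => h₀.cat_not_isBlock h₁ (h ▸ isBlock_eight)⟩
  simpa [t5, s, t] using this

open SeqCoding in
theorem models_t6 : ISigma0 ⊨ᵇ binaryCoding.t6 := by
  refine models_of_forall_realize fun M _ _ _ _ _ _ v => ?_
  have : IsStar (v 0) → IsStar (v 1) →
      (∀ x, CatRel 3 (v 0) x → CatRel 3 (v 1) x → v 0 = v 1) ∧
        ∀ x, CatRel 8 (v 0) x → CatRel 8 (v 1) x → v 0 = v 1 := fun h₀ h₁ => by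
    refine ⟨fun x e₁ e₂ => ?_, fun x e₁ e₂ => ?_⟩
    · rw [catRel_iff isSeq_three h₀.1] at e₁
      rw [catRel_iff isSeq_three h₁.1] at e₂
      exact cat_left_cancel (e₁.symm.trans e₂)
    · rw [catRel_iff isBlock_eight.1 h₀.1] at e₁
      rw [catRel_iff isBlock_eight.1 h₁.1] at e₂
      exact cat_left_cancel (e₁.symm.trans e₂)
  simpa [t6, s, t, p, SameCat] using this

open SeqCoding in
theorem models_t7 : ISigma0 ⊨ᵇ binaryCoding.t7 := by
  refine models_of_forall_realize fun M _ _ _ _ _ _ v => ?_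
  have : IsStar (v 0) → IsStar (v 1) →
      (∀ x, CatRel (v 0) 3 x → CatRel (v 1) 3 x → v 0 = v 1) ∧
        ∀ x, CatRel (v 0) 8 x → CatRel (v 1) 8 x → v 0 = v 1 := fun h₀ h₁ => by
    refine ⟨fun x e₁ e₂ => ?_, fun x e₁ e₂ => ?_⟩
    · rw [catRel_iff h₀.1 isSeq_three] at e₁
      rw [catRel_iff h₁.1 isSeq_three] at e₂
      exact cat_right_cancel (e₁.symm.trans e₂)
    · rw [catRel_iff h₀.1 isBlock_eight.1] at e₁
      rw [catRel_iff h₁.1 isBlock_eight.1] at e₂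
      exact cat_right_cancel (e₁.symm.trans e₂)
  simpa [t7, s, t, p, SameCat] using this

theorem three_ne_eight : (3 : M) ≠ 8 := by
  intro h
  have h₁ : (3 : M) < 8 := by norm_num
  exact h₁.ne h

open SeqCoding in
theorem models_t8 : ISigma0 ⊨ᵇ binaryCoding.t8 := by
  refine models_of_forall_realize fun M _ _ _ _ _ _ v => ?_
  have : IsStar (v 0) → IsStar (v 1) →
      (∀ x, CatRel 3 (v 0) x → ¬ CatRel 8 (v 1) x) ∧
        ∀ x, CatRel (v 0) 3 x → ¬ CatRel (v 1) 8 x := fun h₀ h₁ => by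
    refine ⟨fun x e₁ e₂ => ?_, fun x e₁ e₂ => ?_⟩
    · rw [catRel_iff isSeq_three h₀.1] at e₁
      rw [catRel_iff isBlock_eight.1 h₁.1] at e₂
      exact three_ne_eight
        (isBlock_three.eq_of_cat_eq isBlock_eight h₀.1 h₁.1 (e₁.symm.trans e₂))
    · rw [catRel_iff h₀.1 isSeq_three] at e₁
      rw [catRel_iff h₁.1 isBlock_eight.1] at e₂
      exact three_ne_eight
        (isBlock_three.eq_of_cat_eq' isBlock_eight (e₁.symm.trans e₂))
  simpa [t8, s, t, p, SameCat] using this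

open SeqCoding in
theorem models_t9 : ISigma0 ⊨ᵇ binaryCoding.t9 := by
  refine models_of_forall_realize fun M _ _ _ _ _ _ v => ?_
  have : IsStar (v 0) → v 0 = 3 ∨ v 0 = 8 ∨
      (∃ x, IsStar x ∧ (CatRel 3 x (v 0) ∨ CatRel 8 x (v 0))) ∧
        ∃ x, IsStar x ∧ (CatRel x 3 (v 0) ∨ CatRel x 8 (v 0)) := fun h₀ => by
    rcases h₀.first with h | ⟨w, x, hw, hx, h⟩
    · exact or_assoc.1 (.inl h)
    rcases h₀.last with h' | ⟨z, y, hz, hy, h'⟩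
    · exact or_assoc.1 (.inl h')
    refine .inr (.inr ⟨⟨x, hx, ?_⟩, y, hy, ?_⟩)
    · rcases hw with rfl | rfl
      · exact .inl ((catRel_iff isSeq_three hx.1).2 h)
      · exact .inr ((catRel_iff isBlock_eight.1 hx.1).2 h)
    · rcases hz with rfl | rfl
      · exact .inl ((catRel_iff hy.1 isSeq_three).2 h')
      · exact .inr ((catRel_iff hy.1 isBlock_eight.1).2 h')
  simpa [t9, s, t] using this

end Provable

/-! ### The coding in the standard model -/

section Standard

theorem exists_block_codes (n : ℕ) : ∃ w : ℕ, IsBlock w ∧ Codes n w := by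
  induction n using Nat.strong_induction_on with
  | _ n ih =>
    rcases lt_or_ge n 2 with h | h
    · interval_cases n
      · exact ⟨2, isBlock_two, codes_two.2 rfl⟩
      · exact ⟨3, isBlock_three, codes_three.2 rfl⟩
    -- This inverts `n = 2 * m + 2 + e` with `e ≤ 1`.
    · obtain ⟨w, hw, hc⟩ := ih ((n - 2) / 2) (by omega)
      have he : n % 2 ≤ 1 := by omega
      refine ⟨4 * w + n % 2, hw.four_mul he, (codes_four_mul_iff hw.2.1 he).2 ⟨_, ?_, hc⟩⟩
      omega

theorem codes_block_unique {n w z : ℕ} (hw : IsBlock w) (hz : IsBlock z) (hnw : Codes n w)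
    (hnz : Codes n z) : w = z := by
  induction n using Nat.strong_induction_on generalizing w z with
  | _ n ih =>
    rcases hw.cases with rfl | rfl | ⟨x, d, hx, hd, rfl⟩
    · obtain rfl := codes_two.1 hnw
      exact (eq_of_codes_zero hz hnz).symm
    · obtain rfl := codes_three.1 hnw
      exact (eq_of_codes_one hz hnz).symm
    obtain ⟨m, rfl, hm⟩ := (codes_four_mul_iff hx.2.1 hd).1 hnw
    rcases hz.cases with rfl | rfl | ⟨y, e, hy, he, rfl⟩
    · have := codes_two.1 hnz
      omega
    · have := codes_three.1 hnz
      omega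
    obtain ⟨k, hk, hk'⟩ := (codes_four_mul_iff hy.2.1 he).1 hnz
    obtain rfl : m = k := by omega
    have := ih m (by omega) hx hy hm hk'
    omega

theorem codes_index_unique {n m w : ℕ} (hw : IsBlock w) (hn : Codes n w) (hm : Codes m w) :
    n = m := by
  induction w using Nat.strong_induction_on generalizing n m with
  | _ w ih =>
    rcases hw.cases with rfl | rfl | ⟨x, d, hx, hd, rfl⟩
    · rw [codes_two.1 hn, codes_two.1 hm]
    · rw [codes_three.1 hn, codes_three.1 hm]
    obtain ⟨i, rfl, hi⟩ := (codes_four_mul_iff hx.2.1 hd).1 hn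
    obtain ⟨j, rfl, hj⟩ := (codes_four_mul_iff hx.2.1 hd).1 hm
    have h0 := hx.2.1
    rw [ih x (by omega) hx hi hj]

/-- The code of the sequence `⟨n⟩`. -/
noncomputable def blockCode (n : ℕ) : ℕ := (exists_block_codes n).choose

theorem isBlock_blockCode (n : ℕ) : IsBlock (blockCode n) := (exists_block_codes n).choose_spec.1

theorem codes_blockCode (n : ℕ) : Codes n (blockCode n) := (exists_block_codes n).choose_spec.2

theorem blockCode_injective : Function.Injective blockCode := fun n m h =>
  codes_index_unique (isBlock_blockCode m) (h ▸ codes_blockCode n) (codes_blockCode m)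

/-- The code of a finite sequence. -/
noncomputable def listCode : List ℕ → ℕ
  | [] => 0
  | n :: l => cat (blockCode n) (listCode l)

theorem isSeq_listCode (l : List ℕ) : IsSeq (listCode l) := by
  induction l with
  | nil => exact isSeq_zero
  | cons n l ih => exact (isBlock_blockCode n).1.cat ih

theorem listCode_append (l m : List ℕ) : listCode (l ++ m) = cat (listCode l) (listCode m) := by
  induction l with
  | nil => exact (zero_cat _).symm
  | cons n l ih => rw [List.cons_append, listCode, ih, listCode, cat_assoc]

theorem listCode_cons_ne_zero (n : ℕ) (l : List ℕ) : listCode (n :: l) ≠ 0 := fun h =>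
  (isBlock_blockCode n).2.1 (cat_eq_zero.1 h).1

/-- Equal codes have equal first blocks by irreducibility, and then left cancellation applies. -/
theorem listCode_injective : Function.Injective listCode := by
  intro l
  induction l with
  | nil =>
    intro m h
    cases m with
    | nil => rfl
    | cons n m => exact absurd h.symm (listCode_cons_ne_zero n m)
  | cons k l ih =>
    intro m h
    cases m with
    | nil => exact absurd h (listCode_cons_ne_zero k l)
    | cons n m =>
      rw [listCode, listCode] at h
      have hb := (isBlock_blockCode k).eq_of_cat_eq (isBlock_blockCode n) (isSeq_listCode l)
        (isSeq_listCode m) h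
      rw [hb] at h
      rw [blockCode_injective hb, ih (cat_left_cancel h)]

theorem exists_listCode {x : ℕ} (hx : IsSeq x) : ∃ l, listCode l = x := by
  induction x using Nat.strong_induction_on with
  | _ x ih =>
    rcases eq_or_ne x 0 with rfl | h0
    · exact ⟨[], rfl⟩
    obtain ⟨w, t, hw, ht, rfl⟩ := exists_first_block hx h0
    obtain ⟨l, rfl⟩ := ih t (lt_cat_right hw.2.1 t) ht
    obtain ⟨n, hn⟩ := hw.exists_codes
    exact ⟨n :: l, by
      rw [listCode, codes_block_unique (isBlock_blockCode n) hw (codes_blockCode n) hn]⟩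

theorem mem_listCode (n : ℕ) (l : List ℕ) : Mem n (listCode l) ↔ n ∈ l := by
  induction l with
  | nil => exact iff_of_false (not_mem_zero n) List.not_mem_nil
  | cons k l ih =>
    have hk := isBlock_blockCode k
    rw [listCode, mem_cat hk.1 (isSeq_listCode l), ih, mem_block hk, List.mem_cons]
    refine or_congr_left ⟨fun h => codes_index_unique hk h (codes_blockCode k), ?_⟩
    rintro rfl
    exact codes_blockCode n

theorem listCode_singleton (n : ℕ) : listCode [n] = blockCode n := cat_zero _

theorem isStandard_binaryCoding : binaryCoding.IsStandard := by
  refine ⟨listCode, listCode_injective, fun n => ?_, fun n l => ?_, fun l m n => ?_, ?_, ?_⟩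
  · rw [realize_seq]
    exact ⟨exists_listCode, fun ⟨l, h⟩ => h ▸ isSeq_listCode l⟩
  · rw [realize_mem]
    exact mem_listCode n l
  · rw [realize_cat, listCode_append]
    exact catRel_iff (isSeq_listCode l) (isSeq_listCode m)
  · rw [realize_c₁, listCode_singleton]
    exact codes_block_unique isBlock_three (isBlock_blockCode 1) (codes_three.2 rfl)
      (codes_blockCode 1)
  · rw [realize_c₂, listCode_singleton]
    exact codes_block_unique isBlock_eight (isBlock_blockCode 2) (codes_eight.2 rfl)
      (codes_blockCode 2)

end Standard

/-! ### Semantics of translations -/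

namespace Translation

variable {L L' : FirstOrder.Language.{0, 0}} {τ : Translation L L'}
  {M D : Type} [L'.Structure M] [L.Structure D] {e : D → M}

/-- In the `L'`-structure `M`, the formulas of `τ` define a copy of the `L`-structure `D`. -/
structure Defines (τ : Translation L L') (e : D → M) : Prop where
  injective : Function.Injective e
  dom : ∀ x : Fin 1 → M, τ.dom.Realize x ↔ ∃ d, e d = x 0
  fn : ∀ {l : ℕ} (f : L.Functions l) (xs : Fin l → D) (y : D),
    (τ.fn f).Realize (Fin.snoc (α := fun _ => M) (e ∘ xs) (e y)) ↔ Structure.funMap f xs = y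
  rl : ∀ {l : ℕ} (R : L.Relations l) (xs : Fin l → D),
    (τ.rl R).Realize (e ∘ xs) ↔ Structure.RelMap R xs

namespace Defines

variable (h : τ.Defines e)

include h

theorem realize_domAt {γ : Type} (x : γ) (v : γ → M) :
    (τ.domAt x).Realize v ↔ ∃ d, e d = v x := by
  rw [domAt, Formula.realize_relabel, h.dom]
  rfl

theorem realize_domNonempty [Nonempty D] : M ⊨ τ.domNonempty := by
  rw [domNonempty, Sentence.Realize, Formula.realize_iExs]
  exact ⟨fun _ => e (Classical.arbitrary D), (h.realize_domAt _ _).2 ⟨_, rfl⟩⟩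

theorem exists_comp_eq {l : ℕ} {x : Fin l → M} (hx : ∀ i, ∃ d, e d = x i) :
    ∃ xs : Fin l → D, x = e ∘ xs := by
  choose xs hxs using hx
  exact ⟨xs, funext fun i => (hxs i).symm⟩

theorem realize_fnTotal {l : ℕ} (f : L.Functions l) (v : Fin l → M) :
    (τ.fnTotal f).Realize v := by
  rw [fnTotal, Formula.realize_imp, Formula.realize_iInf, Formula.realize_iExsUnique]
  intro hv
  obtain ⟨xs, rfl⟩ := h.exists_comp_eq fun i => (h.realize_domAt i v).1 (hv i)
  have key : ∀ y : Unit → M, (τ.domAt (Sum.inr ()) ⊓ (τ.fn f).relabel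
      (Fin.snoc (α := fun _ => Fin l ⊕ Unit) (fun i : Fin l => Sum.inl i) (Sum.inr ()))
        ).Realize (Sum.elim (e ∘ xs) y) ↔ y = fun _ => e (Structure.funMap f xs) := by
    intro y
    rw [Formula.realize_inf, h.realize_domAt, Formula.realize_relabel, Fin.comp_snoc]
    constructor
    · rintro ⟨⟨d, hd⟩, hf⟩
      have hd' : e d = y () := hd
      have hf' : (τ.fn f).Realize (Fin.snoc (α := fun _ => M) (e ∘ xs) (y ())) := hf
      rw [← hd', h.fn] at hf'
      exact funext fun _ => by rw [hf', hd']
    · rintro rfl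
      exact ⟨⟨_, rfl⟩, (h.fn f xs _).2 rfl⟩
  exact ⟨_, (key _).2 rfl, fun y hy => (key y).1 hy⟩

theorem realize_graph {β : Type} (t : L.Term β) {v : β → D} {y : D} {w : β ⊕ Unit → M}
    (hv : ∀ b, w (Sum.inl b) = e (v b)) (hy : w (Sum.inr ()) = e y) :
    (τ.graph t).Realize w ↔ t.realize v = y := by
  induction t generalizing y w with
  | var b =>
    rw [graph, Formula.realize_equal, Term.realize_var, Term.realize_var, hv, hy,
      h.injective.eq_iff, Term.realize_var]
  | @func l f ts ih =>
    rw [graph, Formula.realize_iExs, Term.realize]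
    simp only [Formula.realize_inf, Formula.realize_iInf, h.realize_domAt,
      Formula.realize_relabel, Sum.elim_inr]
    have hf : ∀ xs : Fin l → D, (τ.fn f).Realize (Sum.elim w (e ∘ xs) ∘
        Fin.snoc (α := fun _ => (β ⊕ Unit) ⊕ Fin l) (fun i : Fin l => Sum.inr i)
          (Sum.inl (Sum.inr ()))) ↔ Structure.funMap f xs = y := fun xs => by
      rw [← h.fn, Fin.comp_snoc, Sum.elim_inl, hy]
      rfl
    constructor
    · rintro ⟨x, hx, hfx⟩
      obtain ⟨xs, rfl⟩ := h.exists_comp_eq fun i => (hx i).1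
      have : (fun i => (ts i).realize v) = xs := by
        refine funext fun i => (ih i ?_ ?_).1 (hx i).2
        · exact hv
        · rfl
      rw [this]
      exact (hf xs).1 hfx
    · refine fun hfy => ⟨e ∘ fun i => (ts i).realize v,
        fun i => ⟨⟨_, rfl⟩, (ih i ?_ ?_).2 rfl⟩, (hf _).2 hfy⟩
      · exact hv
      · rfl

/-- Relativized quantifiers range exactly over the image of `e`, and the unnesting variables are
forced to be the images of the values of the subterms. -/
theorem realize_tr {α : Type} {n : ℕ} (φ : L.BoundedFormula α n) (v : α → D) (xs : Fin n → D) :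
    (τ.tr φ).Realize (e ∘ v) (e ∘ xs) ↔ φ.Realize v xs := by
  -- After relabeling, free and bound variables share one context; all their values come from `D`.
  have env : ∀ {γ : Type} {n : ℕ} (xs : Fin n → D) (z : γ → M) (b : α ⊕ Fin n),
      Sum.elim (Sum.elim (e ∘ v) ((e ∘ xs) ∘ Fin.castAdd 0) ∘ id) z (Sum.inl b) =
        e (Sum.elim v xs b) := by
    rintro γ n xs z (b | b) <;> rfl
  induction φ with
  | falsum => rfl
  | @equal n t u =>
    refine BoundedFormula.realize_relabel.trans ?_
    rw [BoundedFormula.realize_iExs, BoundedFormula.Realize]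
    simp only [Formula.realize_inf, h.realize_domAt]
    constructor
    · rintro ⟨z, ⟨⟨d, hd⟩, ht⟩, hu⟩
      exact ((h.realize_graph t (env xs z) hd.symm).1 ht).trans
        ((h.realize_graph u (env xs z) hd.symm).1 hu).symm
    · intro htu
      exact ⟨fun _ => e (u.realize (Sum.elim v xs)), ⟨⟨_, rfl⟩,
        (h.realize_graph t (env xs _) rfl).2 htu⟩, (h.realize_graph u (env xs _) rfl).2 rfl⟩
  | @rel n l R ts =>
    refine BoundedFormula.realize_relabel.trans ?_
    rw [BoundedFormula.realize_iExs, BoundedFormula.Realize]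
    simp only [Formula.realize_inf, Formula.realize_iInf, h.realize_domAt,
      Formula.realize_relabel]
    constructor
    · rintro ⟨x, hx, hR⟩
      obtain ⟨ys, rfl⟩ : ∃ ys : Fin l → D, x = e ∘ ys := h.exists_comp_eq fun i => (hx i).1
      have : (fun i => (ts i).realize (Sum.elim v xs)) = ys := by
        refine funext fun i => (h.realize_graph (ts i) ?_ ?_).1 (hx i).2
        · exact env xs _
        · rfl
      rw [this]
      exact (h.rl R ys).1 hR
    · refine fun hR => ⟨e ∘ fun i => (ts i).realize (Sum.elim v xs),
        fun i => ⟨⟨_, rfl⟩,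
        (h.realize_graph (v := Sum.elim v xs) (ts i) ?_ ?_).2 rfl⟩, (h.rl R _).2 hR⟩
      · exact env xs _
      · rfl
  | imp φ ψ ih₁ ih₂ =>
    exact imp_congr (ih₁ xs) (ih₂ xs)
  | @all n φ ih =>
    rw [tr, BoundedFormula.realize_all, BoundedFormula.realize_all]
    have dom : ∀ x : M, (BoundedFormula.relabel (n := n + 1) (k := 0)
        (fun _ => Sum.inr (Fin.last n)) τ.dom : L'.BoundedFormula α (n + 1)).Realize (e ∘ v)
          (Fin.snoc (e ∘ xs) x) ↔ ∃ d, e d = x := fun x => by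
      rw [BoundedFormula.realize_relabel]
      refine (iff_of_eq (congrArg (BoundedFormula.Realize _ _) (Subsingleton.elim _ _))).trans
        ((h.dom _).trans ?_)
      simp
    refine ⟨fun H d => ?_, fun H x hx => ?_⟩
    · refine (ih (Fin.snoc xs d)).1 ?_
      rw [Fin.comp_snoc]
      exact H (e d) ((dom _).2 ⟨d, rfl⟩)
    · obtain ⟨d, rfl⟩ := (dom x).1 hx
      have := (ih (Fin.snoc xs d)).2 (H d)
      rwa [Fin.comp_snoc] at this

theorem models_tr {φ : L.Sentence} : M ⊨ τ.tr φ ↔ D ⊨ φ := by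
  rw [Sentence.Realize, Sentence.Realize, Formula.Realize, Formula.Realize, ← h.realize_tr]
  exact iff_of_eq (congrArg₂ _ (Subsingleton.elim _ _) (Subsingleton.elim _ _))

end Defines

end Translation

/-! ### The strings in a model of `IΣ₀` -/

section Strings

variable (M : Type) [CommSemiring M] [LinearOrder M] [IsStrictOrderedRing M]
  [CanonicallyOrderedAdd M] [arith.Structure M] [Sigma0Model M]

/-- The codes of the nonempty sequences of ones and twos. -/
abbrev StarString : Type := {x : M // IsStar x}

namespace StarString

variable {M}

/-- The string `a`. -/
def a : StarString M := ⟨3, isStar_three⟩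

/-- The string `b`. -/
def b : StarString M := ⟨8, isStar_eight⟩

/-- Concatenation of strings. -/
noncomputable def append (x y : StarString M) : StarString M := ⟨cat x.1 y.1, x.2.cat y.2⟩

/-- The successor of a string. -/
noncomputable def succ (x : StarString M) : StarString M :=
  open Classical in if x = a then b else append x b

theorem succ_eq_iff {x y : StarString M} :
    succ x = y ↔ (x = a ∧ y = b) ∨ (x ≠ a ∧ append x b = y) := by
  by_cases ha : x = a
  · simp [succ, ha, eq_comm]
  · simp [succ, ha]

noncomputable instance : strLang.Structure (StarString M) where
  funMap {n} (f : StrFunc n) :=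
    match n, f with
    | _, .a => fun _ => a
    | _, .b => fun _ => b
    | _, .succ => fun v => succ (v 0)
    | _, .cat => fun v => append (v 0) (v 1)
  RelMap {_} (r : Empty) := r.elim

section Realize

variable {α : Type} (v : α → StarString M)

@[simp] theorem realize_a : Str.a.realize v = a := rfl

@[simp] theorem realize_b : Str.b.realize v = b := rfl

@[simp] theorem realize_succ (t : strLang.Term α) :
    (Str.succ t).realize v = succ (t.realize v) := rfl

@[simp] theorem realize_cat (t u : strLang.Term α) :
    (Str.cat t u).realize v = append (t.realize v) (u.realize v) := rfl

end Realize

theorem isBlock_of_eq_or {w : StarString M} (hw : w = a ∨ w = b) : IsBlock w.1 := by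
  rcases hw with rfl | rfl
  · exact isBlock_three
  · exact isBlock_eight

theorem append_ne {w : StarString M} (hw : w = a ∨ w = b) (x y : StarString M) :
    append x y ≠ w := by
  rintro rfl
  exact x.2.cat_not_isBlock y.2 (isBlock_of_eq_or hw)

theorem append_left_cancel {w x y : StarString M} (h : append w x = append w y) : x = y :=
  Subtype.ext (cat_left_cancel (congrArg Subtype.val h))

theorem append_right_cancel {w x y : StarString M} (h : append x w = append y w) : x = y :=
  Subtype.ext (cat_right_cancel (congrArg Subtype.val h))

theorem append_a_ne_append_b (x y : StarString M) : append x a ≠ append y b := fun h =>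
  three_ne_eight (isBlock_three.eq_of_cat_eq' isBlock_eight (congrArg Subtype.val h))

theorem a_append_ne_b_append (x y : StarString M) : append a x ≠ append b y := fun h =>
  three_ne_eight
    (isBlock_three.eq_of_cat_eq isBlock_eight x.2.1 y.2.1 (congrArg Subtype.val h))

theorem exists_append_left {x : StarString M} (ha : x ≠ a) (hb : x ≠ b) :
    ∃ y, append a y = x ∨ append b y = x := by
  rcases x.2.first with (h | h) | ⟨w, t, rfl | rfl, ht, h⟩
  · exact absurd (Subtype.ext h) ha
  · exact absurd (Subtype.ext h) hb
  · exact ⟨⟨t, ht⟩, .inl (Subtype.ext h.symm)⟩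
  · exact ⟨⟨t, ht⟩, .inr (Subtype.ext h.symm)⟩

theorem exists_append_right {x : StarString M} (ha : x ≠ a) (hb : x ≠ b) :
    ∃ y, append y a = x ∨ append y b = x := by
  rcases x.2.last with (h | h) | ⟨w, t, rfl | rfl, ht, h⟩
  · exact absurd (Subtype.ext h) ha
  · exact absurd (Subtype.ext h) hb
  · exact ⟨⟨t, ht⟩, .inl (Subtype.ext h.symm)⟩
  · exact ⟨⟨t, ht⟩, .inr (Subtype.ext h.symm)⟩

open Str in
theorem models_QTplus : StarString M ⊨ QTplus := by
  rw [Theory.model_iff]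
  intro φ hφ
  rcases hφ with rfl | rfl | rfl | rfl | rfl | rfl <;>
    refine (realize_univClosure _).2 fun v => ?_
  · have : append (append (v 0) (v 1)) (v 2) = append (v 0) (append (v 1) (v 2)) :=
      Subtype.ext (cat_assoc _ _ _)
    simpa [ax1, x, y, z] using this
  · have h := append_ne (.inl rfl) (v 0) (v 1)
    have h' := append_ne (.inr rfl) (v 0) (v 1)
    simpa [ax2, x, y] using ⟨h, h'⟩
  · have h : ∀ w : StarString M, append w (v 0) = append w (v 1) → v 0 = v 1 :=
      fun w => append_left_cancel
    have h' : ∀ w : StarString M, append (v 0) w = append (v 1) w → v 0 = v 1 :=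
      fun w => append_right_cancel
    simpa [ax3, x, y] using ⟨⟨⟨h' StarString.a, h' StarString.b⟩, h StarString.a⟩, h StarString.b⟩
  · simpa [ax4, x, y] using
      ⟨a_append_ne_b_append (v 0) (v 1), append_a_ne_append_b (v 0) (v 1)⟩
  · have : v 0 = StarString.a ∨ v 0 = StarString.b ∨
        (∃ y, append StarString.a y = v 0 ∨ append StarString.b y = v 0) ∧
          ∃ z, append z StarString.a = v 0 ∨ append z StarString.b = v 0 := by
      by_cases ha : v 0 = StarString.a
      · exact .inl ha
      by_cases hb : v 0 = StarString.b
      · exact .inr (.inl hb)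
      exact .inr (.inr ⟨exists_append_left ha hb, exists_append_right ha hb⟩)
    simpa [ax5, x, y, z] using this
  · simpa [ax6, x, y] using succ_eq_iff (x := v 0) (y := v 1)

theorem val_eq_val_iff (x y : StarString M) : y.1 = x.1 ↔ x = y :=
  eq_comm.trans Subtype.ext_iff.symm

theorem defines_translation :
    binaryCoding.translation.Defines (D := StarString M) (M := M) Subtype.val where
  injective := Subtype.val_injective
  dom x := (realize_seqStar x).trans ⟨fun h => ⟨⟨_, h⟩, rfl⟩, fun ⟨d, hd⟩ => hd ▸ d.2⟩
  fn {l} (f : StrFunc l) xs y := by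
    cases f with
    | a =>
      change (Term.equal (Term.var 0) binaryCoding.k₁ : arith.Formula (Fin 1)).Realize _ ↔ a = y
      rw [Formula.realize_equal, realize_k₁]
      exact val_eq_val_iff a y
    | b =>
      change (Term.equal (Term.var 0) binaryCoding.k₂ : arith.Formula (Fin 1)).Realize _ ↔ b = y
      rw [Formula.realize_equal, realize_k₂]
      exact val_eq_val_iff b y
    | succ =>
      refine Iff.trans ?_ succ_eq_iff.symm
      have hc : CatRel (xs 0).1 8 y.1 ↔ append (xs 0) b = y :=
        (catRel_iff (xs 0).2.1 isBlock_eight.1).trans (val_eq_val_iff (append (xs 0) b) y)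
      have ha : (xs 0).1 = 3 ↔ xs 0 = a := (val_eq_val_iff a (xs 0)).trans eq_comm
      have hb : y.1 = 8 ↔ y = b := (val_eq_val_iff b y).trans eq_comm
      rw [← hc, Ne, ← ha, ← hb]
      change Formula.Realize (Term.equal (Term.var 0) binaryCoding.k₁ ⊓
        Term.equal (Term.var 1) binaryCoding.k₂ ⊔ (∼(Term.equal (Term.var 0) binaryCoding.k₁) ⊓
          binaryCoding.Cat (Term.var 0) binaryCoding.k₂ (Term.var 1)) :
            arith.Formula (Fin 2)) _ ↔ _
      simp only [Formula.realize_sup, Formula.realize_inf, Formula.realize_not,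
        Formula.realize_equal, realize_k₁, realize_k₂, realize_Cat]
      rfl
    | cat =>
      refine (ConcatArith.realize_cat _).trans ((catRel_iff (xs 0).2.1 (xs 1).2.1).trans ?_)
      exact val_eq_val_iff (append (xs 0) (xs 1)) y
  rl {_} (r : Empty) := r.elim

end StarString

end Strings

/-- In each model the translation defines a copy of `StarString M`, which satisfies `QTplus`; truth
transfers along the inclusion. -/
theorem isInterpretation_binaryCoding :
    binaryCoding.translation.IsInterpretation QTplus ISigma0 := by
  refine ⟨?_, fun l f => ?_, fun φ hφ => ?_⟩
  · refine models_of_forall_realize fun M _ _ _ _ _ _ v => ?_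
    have : Nonempty (StarString M) := ⟨StarString.a⟩
    have := (StarString.defines_translation (M := M)).realize_domNonempty
    rwa [Sentence.Realize, Subsingleton.elim default v] at this
  · exact models_of_forall_realize fun M _ _ _ _ _ _ v =>
      (StarString.defines_translation (M := M)).realize_fnTotal f v
  · refine models_of_forall_realize fun M _ _ _ _ _ _ v => ?_
    have := (StarString.defines_translation (M := M)).models_tr.2
      (StarString.models_QTplus.realize_of_mem φ hφ)
    rwa [Sentence.Realize, Subsingleton.elim default v] at this

end ConcatArith

theorem theorem2 :
    InterpretableIn QTplus ISigma0 ∧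
    ∃ C : SeqCoding,
      Ar.IsSigma0 C.seq ∧ Ar.IsSigma0 C.mem ∧ Ar.IsSigma0 C.cat ∧
      C.IsStandard ∧
      ISigma0 ⊨ᵇ C.catTotal ∧ ISigma0 ⊨ᵇ C.catBounded ∧ ISigma0 ⊨ᵇ C.catJunk ∧
      ISigma0 ⊨ᵇ C.t0 ∧ ISigma0 ⊨ᵇ C.t1 ∧ ISigma0 ⊨ᵇ C.t2 ∧ ISigma0 ⊨ᵇ C.t3 ∧
      ISigma0 ⊨ᵇ C.t4 ∧ ISigma0 ⊨ᵇ C.t5 ∧ ISigma0 ⊨ᵇ C.t6 ∧ ISigma0 ⊨ᵇ C.t7 ∧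
      ISigma0 ⊨ᵇ C.t8 ∧ ISigma0 ⊨ᵇ C.t9 ∧
      C.translation.IsInterpretation QTplus ISigma0 := by
  exact ⟨⟨_, isInterpretation_binaryCoding⟩, binaryCoding, sigma0Rel_isSeq.isSigma0,
    sigma0Rel_mem.isSigma0, sigma0Rel_catRel.isSigma0, isStandard_binaryCoding, models_catTotal,
    models_catBounded, models_catJunk, models_t0, models_t1, models_t2, models_t3, models_t4,
    models_t5, models_t6, models_t7, models_t8, models_t9, isInterpretation_binaryCoding⟩
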